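/- Let $D\subset\mathbb C^n$ be a bounded domain, let $\delta(z)$ be the Euclidean distance from $z$ to $\partial D$, and let $B^n$ be the open unit ball of $\mathbb C^n$. Let $d_D$ be the Kobayashi distance on $D$, that is, the infimum of the total Poincaré lengths of finite chains of holomorphic discs in $D$ joining two points, where the Poincaré distance of the unit disc is normalized so that $0$ and $t\in[0,1)$ have distance $\log\frac{1+t}{1-t}$; let $B^K_D(z,r)=\{w\in D: d_D(z,w)<r\}$. For $z\in D$ and an injective holomorphic map $f:B^n\to D$ with $f(0)=z$, let $q_{D,f}(z)\in(0,\infty]$ be the supremum of all $r>0$ with $B^K_D(z,r)\subset f(B^n)$, and let $h_D(z)=\inf_f 1/q_{D,f}(z)$ (with $1/\infty=0$), the infimum being over all such $f$. The normalized Fridman invariant $e_D(z)\in(0,1]$ is defined by $\frac1{h_D(z)}=\log\frac{1+e_D(z)}{1-e_D(z)}$ if $h_D(z)>0$, and $e_D(z)=1$ if $h_D(z)=0$. Let $p\in\partial D$ be a $C^2$ boundary point, that is, there are an open neighborhood $U$ of $p$ and a real-valued $C^2$ function $\rho$ on $U$ with $d\rho(p)\neq0$ and $D\cap U=\{x\in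 U:\rho(x)<0\}$. **Theorem.** If there are a sequence of points $z_j\in D$ converging to $p$ and a sequence of positive numbers $\epsilon_j$ converging to $0$ such that $e_D(z_j)>1-\epsilon_j\,\delta(z_j)$ for all $j$, then $D$ is biholomorphic to the unit ball $B^n$. -/

import Mathlib

open Set Filter Topology
open scoped ENNReal

namespace Fridman

noncomputable section

/-- The complex Euclidean space `ℂⁿ` with its Hermitian norm. -/
abbrev Cn (n : ℕ) : Type := EuclideanSpace ℂ (Fin n)

/-- The open unit ball `Bⁿ` of `ℂⁿ`. -/
def unitBall (n : ℕ) : Set (Cn n) := Metric.ball 0 1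

/-- The open unit disc of `ℂ`. -/
def disc : Set ℂ := Metric.ball 0 1

/-- A bounded domain: a bounded, open, connected and non-empty set. -/
structure IsBoundedDomain {n : ℕ} (D : Set (Cn n)) : Prop where
  isOpen : IsOpen D
  isConnected : IsConnected D
  isBounded : Bornology.IsBounded D

/-- `p` is a `C²` boundary point of `D`: near `p` the set `D` is the sublevel set `{ρ < 0}` of a
real `C²` function `ρ` (in the real sense) whose differential at `p` is not zero. -/
def IsC2BoundaryPoint {n : ℕ} (D : Set (Cn n)) (p : Cn n) : Prop :=
  p ∈ frontier D ∧
    ∃ (U : Set (Cn n)) (ρ : Cn n → ℝ), IsOpen U ∧ p ∈ U ∧ ContDiffOn ℝ 2 ρ U ∧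
      fderiv ℝ ρ p ≠ 0 ∧ D ∩ U = {x ∈ U | ρ x < 0}

/-- `δ(z)`: the Euclidean distance from `z` to the boundary of `D`. -/
def boundaryDist {n : ℕ} (D : Set (Cn n)) (z : Cn n) : ℝ := Metric.infDist z (frontier D)

/-- The pseudohyperbolic distance `|a - b| / |1 - b̄ a|` of two points of the unit disc. -/
def pseudoHyp (a b : ℂ) : ℝ := ‖a - b‖ / ‖1 - (starRingEnd ℂ) b * a‖

/-- The Poincaré distance of the unit disc (of curvature `-1`), for which `0` and `t ∈ [0, 1)` have
distance `log ((1 + t) / (1 - t))`. -/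
def poincareDist (a b : ℂ) : ℝ := Real.log ((1 + pseudoHyp a b) / (1 - pseudoHyp a b))

/-- `DiscChain D x y L`: there is a finite chain of holomorphic discs in `D` joining `x` to `y`,
the Poincaré lengths of which add up to `L`. -/
inductive DiscChain {n : ℕ} (D : Set (Cn n)) : Cn n → Cn n → ℝ → Prop
  | nil (x : Cn n) (hx : x ∈ D) : DiscChain D x x 0
  | snoc (x : Cn n) (L : ℝ) (f : ℂ → Cn n) (a b : ℂ)
      (hf : DifferentiableOn ℂ f disc) (hfD : MapsTo f disc D)
      (ha : a ∈ disc) (hb : b ∈ disc) (h : DiscChain D x (f a) L) :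
      DiscChain D x (f b) (L + poincareDist a b)

/-- The Kobayashi (pseudo)distance of `D`: the infimum of the lengths of the chains of holomorphic
discs from `x` to `y`. -/
def kobayashiDist {n : ℕ} (D : Set (Cn n)) (x y : Cn n) : ℝ≥0∞ :=
  ⨅ (L : ℝ) (_ : DiscChain D x y L), ENNReal.ofReal L

/-- The open ball `B^K_D(z, r)` for the Kobayashi distance. -/
def kobayashiBall {n : ℕ} (D : Set (Cn n)) (z : Cn n) (r : ℝ) : Set (Cn n) :=
  {w ∈ D | kobayashiDist D z w < ENNReal.ofReal r}

/-- `f` is an injective holomorphic map from the unit ball into `D` with `f 0 = z`. -/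
structure IsBallEmbedding {n : ℕ} (D : Set (Cn n)) (z : Cn n) (f : Cn n → Cn n) : Prop where
  holo : DifferentiableOn ℂ f (unitBall n)
  mapsTo : MapsTo f (unitBall n) D
  injOn : InjOn f (unitBall n)
  map_zero : f 0 = z

/-- `q_{D,f}(z)`: the supremum, in `[0, ∞]`, of all `r > 0` such that `B^K_D(z, r) ⊆ f(Bⁿ)`. -/
def fridmanQ {n : ℕ} (D : Set (Cn n)) (f : Cn n → Cn n) (z : Cn n) : ℝ≥0∞ :=
  ⨆ (r : ℝ) (_ : 0 < r) (_ : kobayashiBall D z r ⊆ f '' unitBall n), ENNReal.ofReal r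

/-- Fridman's invariant `h_D(z) = inf_f 1 / q_{D,f}(z)`, with `1 / ∞ = 0`. -/
def fridmanH {n : ℕ} (D : Set (Cn n)) (z : Cn n) : ℝ≥0∞ :=
  ⨅ (f : Cn n → Cn n) (_ : IsBallEmbedding D z f), (fridmanQ D f z)⁻¹

/-- The normalized Fridman invariant `e_D(z)`: it is `1` if `h_D(z) = 0`, and else the solution `e`
of `1 / h_D(z) = log ((1 + e) / (1 - e))`, see `fridmanE_spec`. -/
def fridmanE {n : ℕ} (D : Set (Cn n)) (z : Cn n) : ℝ :=
  open Classical in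
  if fridmanH D z = 0 then 1
  else (Real.exp ((fridmanH D z)⁻¹).toReal - 1) / (Real.exp ((fridmanH D z)⁻¹).toReal + 1)

theorem fridmanE_spec {n : ℕ} (D : Set (Cn n)) (z : Cn n) (h : fridmanH D z ≠ 0) :
    fridmanE D z < 1 ∧
      Real.log ((1 + fridmanE D z) / (1 - fridmanE D z)) = ((fridmanH D z)⁻¹).toReal := by
  unfold fridmanE
  rw [if_neg h]
  set t := ((fridmanH D z)⁻¹).toReal
  have ht : 0 < Real.exp t := Real.exp_pos t
  have h1 : Real.exp t + 1 ≠ 0 := by positivity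
  refine ⟨by rw [div_lt_one (by positivity)]; linarith, ?_⟩
  have h2 : 1 + (Real.exp t - 1) / (Real.exp t + 1) = 2 * Real.exp t / (Real.exp t + 1) := by
    field_simp; ring
  have h3 : 1 - (Real.exp t - 1) / (Real.exp t + 1) = 2 / (Real.exp t + 1) := by
    field_simp; ring
  rw [h2, h3, div_div_div_cancel_right₀ h1, mul_div_cancel_left₀ _ two_ne_zero, Real.log_exp]

/-- The sets `D` and `G` are biholomorphic: there are holomorphic maps `D → G` and `G → D` that are
inverse to each other. -/
def Biholomorphic {n : ℕ} (D G : Set (Cn n)) : Prop :=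
  ∃ F H : Cn n → Cn n, DifferentiableOn ℂ F D ∧ DifferentiableOn ℂ H G ∧
    MapsTo F D G ∧ MapsTo H G D ∧ LeftInvOn H F D ∧ RightInvOn H F G

end

end Fridman

/-!
Let `f j` be embeddings of the ball into `D`, centred at `z j`, the images of which contain the
Kobayashi balls of radius `r j` around `z j`; the hypothesis on the Fridman invariant allows
`r j > log (1 / (ε j * δ (z j)))` (`exists_isBallEmbedding_of_lt_fridmanE`). Near a `C²` boundary
point the Kobayashi distance of `z j` from a fixed point of `D` is at most `log (1 / δ (z j)) + C`
(`exists_discChain_le_log`): on the complex line through `z j` in the direction of the gradient, `D`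
contains a disc of fixed radius which has `z j` at depth comparable to `δ (z j)`. As
`log (1 / ε j) → ∞`, the images of the `f j` exhaust `D`. After composition with automorphisms of
the ball (`ballInvolution`) all the `f j` have the same value `x₀ ∈ D` at the centre.

A bounded domain exhausted in this way is biholomorphic to the ball
(`biholomorphic_unitBall_of_exhausting`). The maps and their inverses are bounded, so that they
have holomorphic limits `g` and `h` along an ultrafilter. The limit `h : D → Bⁿ` stays in the open
ball by the maximum principle, and `g ∘ h = id`. Moreover `h (g x) = x` as long as `g x ∈ D`. This
holds for each `x`: the derivative of `g` is invertible at `0`, hence everywhere by Hurwitz's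
theorem, so that `g x` is also a value of some `f j`. In particular no completeness of the Kobayashi
distance is needed.

The inverse of an injective holomorphic map is holomorphic by Osgood's theorem
(`injective_fderiv_of_injOn`), which is proved by induction on the dimension. At a singular point
where the derivative does not vanish, one restricts to a level set of a coordinate of the map. If
the derivative vanishes at all singular points, then the map is constant along a curve of singular
points (`not_injOn_of_fderiv_eq_zero`).

For maps of several variables the Cauchy estimates come from the Schwarz lemma, and Montel's theorem
is replaced by convergence along an ultrafilter (`exists_ultralimit_of_locally_bounded`).
-/

namespace Fridman

/-! ### Holomorphic maps of several variables -/

section SeveralVariables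

open Metric

variable {E F : Type*} [NormedAddCommGroup E] [NormedSpace ℂ E]
  [NormedAddCommGroup F] [NormedSpace ℂ F]

theorem norm_fderiv_le_of_norm_le {f : E → F} {x : E} {r M : ℝ} (hr : 0 < r)
    (hd : DifferentiableOn ℂ f (ball x r)) (hM : ∀ y ∈ ball x r, ‖f y‖ ≤ M) :
    ‖fderiv ℂ f x‖ ≤ 2 * M / r := by
  refine Complex.norm_fderiv_le_div_of_mapsTo_ball hd (fun y hy => ?_) hr
  rw [mem_closedBall, dist_eq_norm]
  linarith [norm_sub_le (f y) (f x), hM y hy, hM x (mem_ball_self hr)]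

theorem norm_fderiv_le_of_norm_le_of_mem {f : E → F} {x y : E} {r M : ℝ} (hr : 0 < r)
    (hd : DifferentiableOn ℂ f (ball x (2 * r))) (hM : ∀ y ∈ ball x (2 * r), ‖f y‖ ≤ M)
    (hy : y ∈ ball x r) : ‖fderiv ℂ f y‖ ≤ 2 * M / r := by
  have hsub : ball y r ⊆ ball x (2 * r) := by
    refine ball_subset_ball' ?_
    rw [mem_ball] at hy
    linarith
  exact norm_fderiv_le_of_norm_le hr (hd.mono hsub) fun z hz => hM z (hsub hz)

theorem norm_sub_le_of_norm_le {f : E → F} {x y z : E} {r M : ℝ} (hr : 0 < r)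
    (hd : DifferentiableOn ℂ f (ball x (2 * r))) (hM : ∀ y ∈ ball x (2 * r), ‖f y‖ ≤ M)
    (hy : y ∈ ball x r) (hz : z ∈ ball x r) : ‖f y - f z‖ ≤ 2 * M / r * ‖y - z‖ := by
  refine (convex_ball x r).norm_image_sub_le_of_norm_fderiv_le (𝕜 := ℂ) (fun w hw => ?_)
    (fun w hw => norm_fderiv_le_of_norm_le_of_mem hr hd hM hw) hz hy
  exact hd.differentiableAt (isOpen_ball.mem_nhds (ball_subset_ball (by linarith) hw))

/-- The derivative of a bounded holomorphic map is locally Lipschitz. This uses only that the map is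
complex differentiable, not that its derivative is. -/
theorem norm_fderiv_sub_le_of_norm_le {f : E → F} {x y z : E} {r M : ℝ} (hr : 0 < r)
    (hd : DifferentiableOn ℂ f (ball x (4 * r))) (hM : ∀ y ∈ ball x (4 * r), ‖f y‖ ≤ M)
    (hy : y ∈ ball x r) (hz : z ∈ ball x r) :
    ‖fderiv ℂ f y - fderiv ℂ f z‖ ≤ 2 * M / r ^ 2 * ‖y - z‖ := by
  have h4 : 2 * (2 * r) = 4 * r := by ring
  have hmem : ∀ {a : E}, a ∈ ball x r → ∀ w ∈ ball (0 : E) r, a + w ∈ ball x (2 * r) := by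
    intro a ha w hw
    rw [mem_ball, dist_eq_norm] at *
    calc ‖a + w - x‖ = ‖(a - x) + (w - 0)‖ := by congr 1; abel
      _ ≤ _ := norm_add_le _ _
      _ < 2 * r := by linarith
  have hda : ∀ {a : E}, a ∈ ball x (2 * r) → DifferentiableAt ℂ f a := fun ha =>
    hd.differentiableAt (isOpen_ball.mem_nhds (ball_subset_ball (by linarith) ha))
  -- the derivative of `w ↦ f (y + w) - f (z + w)` at `0` is estimated by Cauchy's inequality
  have key : ‖fderiv ℂ (fun w => f (y + w) - f (z + w)) 0‖ ≤
      2 * (2 * M / (2 * r) * ‖y - z‖) / r := by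
    refine norm_fderiv_le_of_norm_le hr (fun w hw => ?_) (fun w hw => ?_)
    · refine DifferentiableAt.differentiableWithinAt ?_
      exact ((hda (hmem hy w hw)).comp w (by fun_prop : DifferentiableAt ℂ (fun w => y + w) w)).sub
        ((hda (hmem hz w hw)).comp w (by fun_prop : DifferentiableAt ℂ (fun w => z + w) w))
    · have h := norm_sub_le_of_norm_le (by linarith : 0 < 2 * r) (f := f) (x := x) (M := M)
        (by rwa [h4]) (by rwa [h4]) (hmem hy w hw) (hmem hz w hw)
      convert h using 3
      abel
  have h1 : fderiv ℂ (fun w => f (y + w) - f (z + w)) 0 = fderiv ℂ f y - fderiv ℂ f z := by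
    have h0 : (0 : E) ∈ ball (0 : E) r := mem_ball_self hr
    rw [fderiv_fun_sub]
    · simp [fderiv_comp_add_left]
    · exact (hda (hmem hy 0 h0)).comp 0 (by fun_prop : DifferentiableAt ℂ (fun w => y + w) 0)
    · exact (hda (hmem hz 0 h0)).comp 0 (by fun_prop : DifferentiableAt ℂ (fun w => z + w) 0)
  rw [h1] at key
  refine key.trans (le_of_eq ?_)
  field_simp

theorem norm_sub_sub_fderiv_le_of_norm_le {f : E → F} {x y z : E} {r M : ℝ} (hr : 0 < r)
    (hd : DifferentiableOn ℂ f (ball x (4 * r))) (hM : ∀ y ∈ ball x (4 * r), ‖f y‖ ≤ M)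
    (hy : y ∈ ball x r) (hz : z ∈ ball x r) :
    ‖f y - f z - fderiv ℂ f z (y - z)‖ ≤ 2 * M / r ^ 2 * ‖y - z‖ * ‖y - z‖ := by
  have hM0 : 0 ≤ M := (norm_nonneg _).trans (hM x (mem_ball_self (by linarith)))
  have hconv := (convex_ball x r).inter (convex_closedBall z ‖y - z‖)
  refine hconv.norm_image_sub_le_of_norm_fderiv_le' (𝕜 := ℂ)
    (fun w hw => ?_) (fun w hw => ?_) ⟨hz, mem_closedBall_self (norm_nonneg _)⟩
    ⟨hy, by rw [mem_closedBall, dist_eq_norm]⟩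
  · exact hd.differentiableAt (isOpen_ball.mem_nhds (ball_subset_ball (by linarith) hw.1))
  · refine (norm_fderiv_sub_le_of_norm_le hr hd hM hw.1 hz).trans ?_
    have := hw.2
    rw [mem_closedBall, dist_eq_norm] at this
    gcongr

theorem exists_tendsto_ultrafilter_of_norm_le {ι G : Type*} [NormedAddCommGroup G] [ProperSpace G]
    (𝒰 : Ultrafilter ι) {f : ι → G} {M : ℝ} (h : ∀ᶠ i in (𝒰 : Filter ι), ‖f i‖ ≤ M) :
    ∃ v, Tendsto f 𝒰 (𝓝 v) := by
  obtain ⟨v, -, hv⟩ := (isCompact_closedBall (0 : G) M).ultrafilter_le_nhds (𝒰.map f)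
    (by
      rw [le_principal_iff, Ultrafilter.mem_coe, Ultrafilter.mem_map]
      filter_upwards [h] with i hi using mem_closedBall_zero_iff.2 hi)
  exact ⟨v, hv⟩

/-- A substitute for Montel's theorem: along an ultrafilter every locally bounded family of
holomorphic maps converges, together with its derivatives, to a holomorphic map. The convergence is
stated as continuous convergence, which gives `f i (y i) → g x` whenever `y i → x`. -/
theorem exists_ultralimit_of_locally_bounded {ι : Type*} [FiniteDimensional ℂ E]
    [FiniteDimensional ℂ F] (𝒰 : Ultrafilter ι) {U : Set E} (f : ι → E → F)
    (h : ∀ x ∈ U, ∃ r > 0, ∃ M : ℝ, ∀ᶠ i in (𝒰 : Filter ι),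
      DifferentiableOn ℂ (f i) (ball x r) ∧ ∀ y ∈ ball x r, ‖f i y‖ ≤ M) :
    ∃ g : E → F, ∀ x ∈ U, DifferentiableAt ℂ g x ∧
      Tendsto (fun q : ι × E => f q.1 q.2) ((𝒰 : Filter ι) ×ˢ 𝓝 x) (𝓝 (g x)) ∧
      Tendsto (fun q : ι × E => fderiv ℂ (f q.1) q.2) ((𝒰 : Filter ι) ×ˢ 𝓝 x)
        (𝓝 (fderiv ℂ g x)) := by
  have : ProperSpace F := FiniteDimensional.proper ℂ F
  have : ProperSpace (E →L[ℂ] F) := FiniteDimensional.proper ℂ _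
  refine ⟨fun x => limUnder (𝒰 : Filter ι) fun i => f i x, fun x hx => ?_⟩
  set g : E → F := fun x => limUnder (𝒰 : Filter ι) fun i => f i x with hg
  obtain ⟨R, hR, M, hM⟩ := h x hx
  obtain ⟨r, hr, rfl⟩ : ∃ r > 0, R = 4 * r := ⟨R / 4, by positivity, by ring⟩
  have hxr : x ∈ ball x r := mem_ball_self hr
  have hgl : ∀ y ∈ ball x r, Tendsto (fun i => f i y) 𝒰 (𝓝 (g y)) := fun y hy =>
    tendsto_nhds_limUnder <| exists_tendsto_ultrafilter_of_norm_le 𝒰 (M := M) <| by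
      filter_upwards [hM] with i hi using hi.2 y (ball_subset_ball (by linarith) hy)
  obtain ⟨G, hG⟩ : ∃ G, Tendsto (fun i => fderiv ℂ (f i) x) 𝒰 (𝓝 G) :=
    exists_tendsto_ultrafilter_of_norm_le 𝒰 (M := 2 * M / (4 * r)) <| by
      filter_upwards [hM] with i hi using norm_fderiv_le_of_norm_le hR hi.1 hi.2
  -- the second order Taylor estimate passes to the limit
  have hTaylor : ∀ y ∈ ball x r, ‖g y - g x - G (y - x)‖ ≤ 2 * M / r ^ 2 * ‖y - x‖ * ‖y - x‖ := by
    intro y hy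
    refine le_of_tendsto (((hgl y hy).sub (hgl x hxr)).sub
      (((ContinuousLinearMap.apply ℂ F (y - x)).continuous.tendsto G).comp hG)).norm ?_
    filter_upwards [hM] with i hi
    exact norm_sub_sub_fderiv_le_of_norm_le hr hi.1 hi.2 hy hxr
  have hderiv : HasFDerivAt g G x := by
    rw [hasFDerivAt_iff_isLittleO]
    have h1 : (fun y => g y - g x - G (y - x)) =O[𝓝 x] fun y => ‖y - x‖ * ‖y - x‖ := by
      refine Asymptotics.IsBigO.of_bound (2 * M / r ^ 2) ?_
      filter_upwards [ball_mem_nhds x hr] with y hy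
      rw [norm_mul, norm_norm, ← mul_assoc]
      exact hTaylor y hy
    refine h1.trans_isLittleO ?_
    have h2 : (fun y => ‖y - x‖) =o[𝓝 x] fun _ => (1 : ℝ) := by
      rw [Asymptotics.isLittleO_one_iff]
      have : Continuous fun y : E => ‖y - x‖ := by fun_prop
      simpa using this.tendsto x
    simpa using (h2.mul_isBigO (Asymptotics.isBigO_refl (fun y : E => ‖y - x‖) (𝓝 x))).norm_right
  have h4 : 2 * (2 * r) = 4 * r := by ring
  have hsnd : Tendsto (fun q : ι × E => ‖q.2 - x‖) ((𝒰 : Filter ι) ×ˢ 𝓝 x) (𝓝 0) := by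
    have : Continuous fun y : E => ‖y - x‖ := by fun_prop
    have h0 := (this.tendsto x).comp (tendsto_snd (f := (𝒰 : Filter ι)) (g := 𝓝 x))
    rwa [sub_self, norm_zero] at h0
  have hev : ∀ᶠ q : ι × E in (𝒰 : Filter ι) ×ˢ 𝓝 x,
      (DifferentiableOn ℂ (f q.1) (ball x (4 * r)) ∧ ∀ y ∈ ball x (4 * r), ‖f q.1 y‖ ≤ M) ∧
        q.2 ∈ ball x r := hM.prod_mk (ball_mem_nhds x hr)
  refine ⟨hderiv.differentiableAt, ?_, ?_⟩
  · have h1 : Tendsto (fun q : ι × E => f q.1 q.2 - f q.1 x) ((𝒰 : Filter ι) ×ˢ 𝓝 x) (𝓝 0) := by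
      refine squeeze_zero_norm' ?_ (by simpa using hsnd.const_mul (2 * M / (2 * r)))
      filter_upwards [hev] with q hq
      exact norm_sub_le_of_norm_le (by linarith : 0 < 2 * r) (x := x)
        (by rw [h4]; exact hq.1.1) (by rw [h4]; exact hq.1.2)
        (ball_subset_ball (by linarith) hq.2) (ball_subset_ball (by linarith) hxr)
    simpa using h1.add ((hgl x hxr).comp tendsto_fst)
  · rw [hderiv.fderiv]
    have h1 : Tendsto (fun q : ι × E => fderiv ℂ (f q.1) q.2 - fderiv ℂ (f q.1) x)
        ((𝒰 : Filter ι) ×ˢ 𝓝 x) (𝓝 0) := by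
      refine squeeze_zero_norm' ?_ (by simpa using hsnd.const_mul (2 * M / r ^ 2))
      filter_upwards [hev] with q hq
      exact norm_fderiv_sub_le_of_norm_le hr hq.1.1 hq.1.2 hq.2 hxr
    simpa using h1.add (hG.comp tendsto_fst)

theorem exists_norm_le_ball_of_differentiableOn {f : E → F} {U : Set E} (hU : IsOpen U)
    (hf : DifferentiableOn ℂ f U) {x : E} (hx : x ∈ U) :
    ∃ r > 0, ball x (4 * r) ⊆ U ∧ ∃ M : ℝ, ∀ y ∈ ball x (4 * r), ‖f y‖ ≤ M := by
  have hc : ContinuousAt f x := (hf.differentiableAt (hU.mem_nhds hx)).continuousAt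
  have h1 : ∀ᶠ y in 𝓝 x, y ∈ U ∧ ‖f y‖ < ‖f x‖ + 1 :=
    (hU.eventually_mem hx).and (hc.norm.eventually_lt_const (lt_add_one _))
  obtain ⟨R, hR, h2⟩ := Metric.eventually_nhds_iff_ball.1 h1
  refine ⟨R / 4, by positivity, ?_, ‖f x‖ + 1, ?_⟩ <;> rw [mul_div_cancel₀ _ four_ne_zero]
  · exact fun y hy => (h2 y hy).1
  · exact fun y hy => (h2 y hy).2.le

/-- The derivative of a holomorphic map is holomorphic: each partial derivative is a locally bounded
pointwise limit of difference quotients. -/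
theorem differentiableOn_fderiv [FiniteDimensional ℂ E] [FiniteDimensional ℂ F] {f : E → F}
    {U : Set E} (hU : IsOpen U) (hf : DifferentiableOn ℂ f U) :
    DifferentiableOn ℂ (fderiv ℂ f) U := by
  intro x hx
  refine DifferentiableAt.differentiableWithinAt ?_
  have hpartial : ∀ v : E, DifferentiableAt ℂ (fun y => fderiv ℂ f y v) x := by
    intro v
    let 𝒰 : Ultrafilter ℂ := Ultrafilter.of (𝓝[≠] (0 : ℂ))
    have h𝒰 : (𝒰 : Filter ℂ) ≤ 𝓝[≠] (0 : ℂ) := Ultrafilter.of_le _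
    have hbd : ∀ x ∈ U, ∃ r > 0, ∃ M : ℝ, ∀ᶠ h in (𝒰 : Filter ℂ),
        DifferentiableOn ℂ (fun y => h⁻¹ • (f (y + h • v) - f y)) (ball x r) ∧
          ∀ y ∈ ball x r, ‖h⁻¹ • (f (y + h • v) - f y)‖ ≤ M := by
      intro x hx
      obtain ⟨r, hr, hrU, M, hM⟩ := exists_norm_le_ball_of_differentiableOn hU hf hx
      have hM0 : 0 ≤ M := (norm_nonneg _).trans (hM x (mem_ball_self (by linarith)))
      have h4 : 2 * (2 * r) = 4 * r := by ring
      refine ⟨r, hr, 2 * M / (2 * r) * ‖v‖, h𝒰 ?_⟩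
      have hsmall : ∀ᶠ h : ℂ in 𝓝[≠] (0 : ℂ), ‖h • v‖ < r := by
        have : ContinuousAt (fun h : ℂ => ‖h • v‖) 0 := by fun_prop
        exact nhdsWithin_le_nhds (this.eventually_lt_const (by simpa using hr))
      filter_upwards [hsmall, self_mem_nhdsWithin] with h hh hh0
      have hmem : ∀ y ∈ ball x r, y + h • v ∈ ball x (2 * r) := by
        intro y hy
        rw [mem_ball, dist_eq_norm] at *
        calc ‖y + h • v - x‖ = ‖(y - x) + h • v‖ := by congr 1; abel
          _ ≤ _ := norm_add_le _ _
          _ < 2 * r := by linarith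
      have hda : ∀ {a : E}, a ∈ ball x (2 * r) → DifferentiableAt ℂ f a := fun ha =>
        hf.differentiableAt (hU.mem_nhds (hrU (ball_subset_ball (by linarith) ha)))
      constructor
      · intro y hy
        refine DifferentiableAt.differentiableWithinAt ?_
        exact ((((hda (hmem y hy)).comp y
          (by fun_prop : DifferentiableAt ℂ (fun y => y + h • v) y)).sub
          (hda (ball_subset_ball (by linarith) hy))).const_smul h⁻¹)
      · intro y hy
        have h1 := norm_sub_le_of_norm_le (by linarith : 0 < 2 * r) (f := f) (x := x) (M := M)
          (by rw [h4]; exact hf.mono hrU) (by rwa [h4])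
          (hmem y hy) (ball_subset_ball (by linarith) hy)
        rw [norm_smul, norm_inv]
        rw [add_sub_cancel_left, norm_smul] at h1
        have hpos : 0 < ‖h‖ := norm_pos_iff.2 hh0
        rw [inv_mul_le_iff₀ hpos]
        linarith
    obtain ⟨g, hg⟩ := exists_ultralimit_of_locally_bounded 𝒰 _ hbd
    refine (hg x hx).1.congr_of_eventuallyEq ?_
    filter_upwards [hU.mem_nhds hx] with y hy
    have h1 := (hg y hy).2.1.comp ((tendsto_id (x := (𝒰 : Filter ℂ))).prodMk
      (tendsto_const_nhds (x := y)))
    have h2 := (((hf.differentiableAt (hU.mem_nhds hy)).hasFDerivAt.hasLineDerivAt v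
      ).tendsto_slope_zero).mono_left h𝒰
    exact tendsto_nhds_unique h2 h1
  let b := Module.finBasis ℂ E
  have hsum : fderiv ℂ f = fun y => ∑ i,
      (LinearMap.toContinuousLinearMap (b.coord i)).smulRight (fderiv ℂ f y (b i)) := by
    funext y
    ext w
    conv_lhs => rw [← b.sum_repr w, map_sum]
    simp
  rw [hsum]
  refine DifferentiableAt.fun_sum fun i _ => ?_
  exact (ContinuousLinearMap.smulRightL ℂ E F
    (LinearMap.toContinuousLinearMap (b.coord i))).differentiableAt.comp x (hpartial (b i))

theorem contDiffOn_one_of_differentiableOn [FiniteDimensional ℂ E] [FiniteDimensional ℂ F]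
    {f : E → F} {U : Set E} (hU : IsOpen U) (hf : DifferentiableOn ℂ f U) :
    ContDiffOn ℂ 1 f U := by
  have h := (contDiffOn_succ_iff_fderiv_of_isOpen (n := 0) hU (f := f) (𝕜 := ℂ)).2
  simp only [zero_add] at h
  exact h ⟨hf, by simp, contDiffOn_zero.2 (differentiableOn_fderiv hU hf).continuousOn⟩

theorem hasStrictFDerivAt_of_differentiableOn [FiniteDimensional ℂ E] [FiniteDimensional ℂ F]
    {f : E → F} {U : Set E} (hU : IsOpen U) (hf : DifferentiableOn ℂ f U) {x : E} (hx : x ∈ U) :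
    HasStrictFDerivAt f (fderiv ℂ f x) x :=
  ((contDiffOn_one_of_differentiableOn hU hf).contDiffAt (hU.mem_nhds hx)).hasStrictFDerivAt
    one_ne_zero

end SeveralVariables

/-! ### Zeros of holomorphic functions along parallel lines -/

section Zeros

open Metric

/-- A holomorphic function has a zero in a disc if it is smaller at the centre than on the boundary
circle, by the maximum principle for its inverse. -/
theorem exists_zero_of_norm_lt_on_sphere {f : ℂ → ℂ} {c : ℂ} {r m : ℝ} (hr : 0 < r)
    (hf : DiffContOnCl ℂ f (ball c r)) (hm : ∀ z ∈ sphere c r, m ≤ ‖f z‖) (hc : ‖f c‖ < m) :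
    ∃ z ∈ ball c r, f z = 0 := by
  by_contra! h
  have hm0 : 0 < m := (norm_nonneg _).trans_lt hc
  have h0 : ∀ z ∈ closure (ball c r), f z ≠ 0 := by
    intro z hz
    rw [closure_ball c hr.ne', ← ball_union_sphere] at hz
    rcases hz with hz | hz
    · exact h z hz
    · exact norm_pos_iff.1 (hm0.trans_le (hm z hz))
  have h1 := Complex.norm_le_of_forall_mem_frontier_norm_le (C := m⁻¹) isBounded_ball (hf.inv h0)
    (fun z hz => by
      rw [frontier_ball c hr.ne'] at hz
      rw [Pi.inv_apply, norm_inv]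
      exact inv_anti₀ hm0 (hm z hz)) (subset_closure (mem_ball_self hr))
  rw [Pi.inv_apply, norm_inv] at h1
  have h2 := (inv_le_inv₀ (norm_pos_iff.2 (h c (mem_ball_self hr))) hm0).1 h1
  linarith

variable {E : Type*} [NormedAddCommGroup E] [NormedSpace ℂ E]

/-- The iterated derivatives of `J` in the direction `u`. -/
noncomputable def dirDeriv (J : E → ℂ) (u : E) : ℕ → E → ℂ
  | 0 => J
  | n + 1 => fun z => fderiv ℂ (dirDeriv J u n) z u

theorem differentiableOn_dirDeriv [FiniteDimensional ℂ E] {J : E → ℂ} {U : Set E} (hU : IsOpen U)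
    (hJ : DifferentiableOn ℂ J U) (u : E) (n : ℕ) : DifferentiableOn ℂ (dirDeriv J u n) U := by
  induction n with
  | zero => exact hJ
  | succ n ih => exact (differentiableOn_fderiv hU ih).clm_apply (differentiableOn_const u)

theorem hasDerivAt_comp_line {F : Type*} [NormedAddCommGroup F] [NormedSpace ℂ F] {f : E → F}
    {a u : E} {s : ℂ} (hf : DifferentiableAt ℂ f (a + s • u)) :
    HasDerivAt (fun s : ℂ => f (a + s • u)) (fderiv ℂ f (a + s • u) u) s := by
  have h1 : HasDerivAt (fun s : ℂ => a + s • u) u s := by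
    simpa using ((hasDerivAt_id s).smul_const u).const_add a
  exact hf.hasFDerivAt.comp_hasDerivAt s h1

theorem tendsto_line (a u : E) : Tendsto (fun s : ℂ => a + s • u) (𝓝 0) (𝓝 a) := by
  have : Continuous fun s : ℂ => a + s • u := by fun_prop
  simpa using this.tendsto 0

/-- If all iterated derivatives in the direction `u` vanish at `a`, then the function vanishes on
the complex line through `a` in this direction, near `a`. -/
theorem exists_dirDeriv_ne_zero [FiniteDimensional ℂ E] {J : E → ℂ} {U : Set E} (hU : IsOpen U)
    (hJ : DifferentiableOn ℂ J U) {a u : E} (ha : a ∈ U)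
    (hne : ∃ᶠ s in 𝓝 (0 : ℂ), J (a + s • u) ≠ 0) : ∃ n, dirDeriv J u n a ≠ 0 := by
  by_contra! h
  obtain ⟨r, hr, hrU⟩ := Metric.eventually_nhds_iff_ball.1
    ((tendsto_line a u).eventually (hU.eventually_mem ha))
  have hiter : ∀ n, ∀ s ∈ ball (0 : ℂ) r,
      iteratedDeriv n (fun s : ℂ => J (a + s • u)) s = dirDeriv J u n (a + s • u) := by
    intro n
    induction n with
    | zero => intro s _; simp [dirDeriv]
    | succ n ih =>
      intro s hs
      rw [iteratedDeriv_succ]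
      have : iteratedDeriv n (fun s => J (a + s • u)) =ᶠ[𝓝 s]
          fun s => dirDeriv J u n (a + s • u) := by
        filter_upwards [isOpen_ball.mem_nhds hs] with s' hs' using ih s' hs'
      rw [this.deriv_eq]
      exact (hasDerivAt_comp_line ((differentiableOn_dirDeriv hU hJ u n).differentiableAt
        (hU.mem_nhds (hrU s hs)))).deriv
  have hd : DifferentiableOn ℂ (fun s : ℂ => J (a + s • u)) (ball 0 r) := fun s hs =>
    (hasDerivAt_comp_line (hJ.differentiableAt
      (hU.mem_nhds (hrU s hs)))).differentiableAt.differentiableWithinAt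
  refine hne ?_
  filter_upwards [ball_mem_nhds (0 : ℂ) hr] with s hs
  have h1 := Complex.taylorSeries_eq_on_ball' hs hd
  rw [not_not, ← h1]
  simp [hiter _ 0 (mem_ball_self hr), h]

theorem frequently_ne_zero_of_dirDeriv_ne_zero [FiniteDimensional ℂ E] {J : E → ℂ} {U : Set E}
    (hU : IsOpen U) (hJ : DifferentiableOn ℂ J U) {a u : E} (ha : a ∈ U) {n : ℕ}
    (hn : dirDeriv J u n a ≠ 0) : ∃ᶠ s in 𝓝 (0 : ℂ), J (a + s • u) ≠ 0 := by
  intro hev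
  simp only [not_not] at hev
  have key : ∀ n, ∀ᶠ s in 𝓝 (0 : ℂ), dirDeriv J u n (a + s • u) = 0 := by
    intro n
    induction n with
    | zero => exact hev
    | succ n ih =>
      filter_upwards [ih.eventually_nhds, (tendsto_line a u).eventually (hU.eventually_mem ha)]
        with s hs hsU
      have h1 := (hasDerivAt_comp_line ((differentiableOn_dirDeriv hU hJ u n).differentiableAt
        (hU.mem_nhds hsU))).deriv
      have h2 : (fun s => dirDeriv J u n (a + s • u)) =ᶠ[𝓝 s] fun _ => (0 : ℂ) := hs
      rw [h2.deriv_eq, deriv_const] at h1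
      exact h1.symm
  exact hn (by simpa using (key n).self_of_nhds)

/-- Near a suitable zero `b` of `J` the zero set of `J` is contained in the zero set of a
holomorphic `ψ` the derivative of which does not vanish in the direction `u`. The zero `b` is one
at which the order of vanishing along `u` is minimal. -/
theorem exists_regular_zero [FiniteDimensional ℂ E] {J : E → ℂ} {U : Set E} (hU : IsOpen U)
    (hJ : DifferentiableOn ℂ J U) {a u : E} (ha : a ∈ U) (hJa : J a = 0)
    (hne : ∃ᶠ s in 𝓝 (0 : ℂ), J (a + s • u) ≠ 0) :
    ∃ b ∈ U, J b = 0 ∧ (∃ᶠ s in 𝓝 (0 : ℂ), J (b + s • u) ≠ 0) ∧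
      ∃ ψ : E → ℂ, DifferentiableOn ℂ ψ U ∧ (∀ z ∈ U, J z = 0 → ψ z = 0) ∧ fderiv ℂ ψ b u ≠ 0 := by
  classical
  have hex : ∃ n, ∃ z ∈ U, J z = 0 ∧ dirDeriv J u n z ≠ 0 := by
    obtain ⟨n, hn⟩ := exists_dirDeriv_ne_zero hU hJ ha hne
    exact ⟨n, a, ha, hJa, hn⟩
  obtain ⟨b, hbU, hJb, hb⟩ := Nat.find_spec hex
  have hmin : ∀ m < Nat.find hex, ∀ z ∈ U, J z = 0 → dirDeriv J u m z = 0 := by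
    intro m hm z hz hJz
    by_contra hcon
    exact Nat.find_min hex hm ⟨z, hz, hJz, hcon⟩
  refine ⟨b, hbU, hJb, frequently_ne_zero_of_dirDeriv_ne_zero hU hJ hbU hb, ?_⟩
  cases hN : Nat.find hex with
  | zero => rw [hN] at hb; exact absurd hJb hb
  | succ N =>
    rw [hN] at hb
    exact ⟨dirDeriv J u N, differentiableOn_dirDeriv hU hJ u N, hmin N (by omega), hb⟩

/-- Zeros of `J` near an isolated zero on a complex line persist on the parallel lines. -/
theorem exists_zero_on_parallel_lines {J : E → ℂ} {U : Set E} (hU : IsOpen U)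
    (hJ : DifferentiableOn ℂ J U) {b u : E} (v : E) (hb : b ∈ U) (hJb : J b = 0)
    (hne : ∃ᶠ s in 𝓝 (0 : ℂ), J (b + s • u) ≠ 0) {W : Set E} (hW : W ∈ 𝓝 b) :
    ∀ᶠ t in 𝓝 (0 : ℂ), ∃ s : ℂ, b + s • u + t • v ∈ W ∧ J (b + s • u + t • v) = 0 := by
  have hcont : Continuous fun q : ℂ × ℂ => b + q.1 • u + q.2 • v := by fun_prop
  have htend : Tendsto (fun q : ℂ × ℂ => b + q.1 • u + q.2 • v) (𝓝 0 ×ˢ 𝓝 0) (𝓝 b) := by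
    have := hcont.tendsto (0, 0)
    rw [nhds_prod_eq] at this
    simpa using this
  have hUW : U ∩ W ∈ 𝓝 b := inter_mem (hU.mem_nhds hb) hW
  obtain ⟨S, hS, T, hT, hST⟩ := mem_prod_iff.1 (htend hUW)
  -- on a small circle around `0` the function `s ↦ J (b + s • u)` has no zeros
  have hana : AnalyticAt ℂ (fun s : ℂ => J (b + s • u)) 0 := by
    rw [Complex.analyticAt_iff_eventually_differentiableAt]
    filter_upwards [(tendsto_line b u).eventually (hU.eventually_mem hb)] with s hs
    exact (hasDerivAt_comp_line (hJ.differentiableAt (hU.mem_nhds hs))).differentiableAt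
  have hiso := (hana.eventually_eq_zero_or_eventually_ne_zero).resolve_left
    fun h => hne (by simpa using h)
  rw [eventually_nhdsWithin_iff] at hiso
  obtain ⟨R, hR, hRS⟩ := Metric.eventually_nhds_iff_ball.1 (hiso.and hS)
  obtain ⟨r, hr, hrR⟩ := exists_between hR
  have hJat : ∀ s ∈ closedBall (0 : ℂ) r, ∀ t ∈ T,
      DifferentiableAt ℂ J (b + s • u + t • v) := by
    intro s hs t ht
    refine hJ.differentiableAt (hU.mem_nhds ?_)
    exact (hST (mk_mem_prod (hRS s (closedBall_subset_ball hrR hs)).2 ht)).1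
  have hT0 : (0 : ℂ) ∈ T := mem_of_mem_nhds hT
  have hsphere : ∀ s ∈ sphere (0 : ℂ) r, J (b + s • u) ≠ 0 := fun s hs =>
    (hRS s (closedBall_subset_ball hrR (sphere_subset_closedBall hs))).1
      (by simpa using ne_of_mem_sphere hs hr.ne')
  obtain ⟨s₀, hs₀, hmin⟩ := (isCompact_sphere (0 : ℂ) r).exists_isMinOn
    (NormedSpace.sphere_nonempty.2 hr.le) (f := fun s => ‖J (b + s • u)‖) (by
      intro s hs
      have h1 := (hJat s (sphere_subset_closedBall hs) 0 hT0)
      rw [zero_smul, add_zero] at h1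
      exact (hasDerivAt_comp_line h1).continuousAt.continuousWithinAt.norm)
  set m := ‖J (b + s₀ • u)‖ with hm
  have hm0 : 0 < m := norm_pos_iff.2 (hsphere s₀ hs₀)
  have hev1 : ∀ᶠ t in 𝓝 (0 : ℂ), ∀ s ∈ sphere (0 : ℂ) r, m / 2 ≤ ‖J (b + s • u + t • v)‖ := by
    refine (isCompact_sphere (0 : ℂ) r).eventually_forall_of_forall_eventually fun s hs => ?_
    have h1 : ContinuousAt (fun q : ℂ × ℂ => ‖J (b + q.2 • u + q.1 • v)‖) (0, s) := by
      refine ContinuousAt.norm (ContinuousAt.comp (f := fun q : ℂ × ℂ => b + q.2 • u + q.1 • v)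
        (hJat s (sphere_subset_closedBall hs) 0 hT0).continuousAt ?_)
      fun_prop
    have h2 : m / 2 < ‖J (b + s • u + (0 : ℂ) • v)‖ := by
      have := hmin hs
      simp only [Set.mem_ofPred_eq] at this
      rw [zero_smul, add_zero]
      linarith
    filter_upwards [h1.eventually_const_lt h2] with q hq using hq.le
  have hev2 : ∀ᶠ t in 𝓝 (0 : ℂ), ‖J (b + (0 : ℂ) • u + t • v)‖ < m / 2 := by
    have h1 : ContinuousAt (fun t : ℂ => ‖J (b + (0 : ℂ) • u + t • v)‖) 0 := by
      refine ContinuousAt.norm (ContinuousAt.comp (f := fun t : ℂ => b + (0 : ℂ) • u + t • v)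
        (hJat 0 (mem_closedBall_self hr.le) 0 hT0).continuousAt ?_)
      fun_prop
    exact h1.eventually_lt_const (by simpa [hJb] using half_pos hm0)
  filter_upwards [hT, hev1, hev2] with t ht h1 h2
  have hdt : ∀ s ∈ closedBall (0 : ℂ) r,
      DifferentiableAt ℂ (fun s : ℂ => J (b + s • u + t • v)) s := by
    intro s hs
    exact (hJat s hs t ht).comp s
      (by fun_prop : DifferentiableAt ℂ (fun s : ℂ => b + s • u + t • v) s)
  obtain ⟨s, hs, hJs⟩ := exists_zero_of_norm_lt_on_sphere (f := fun s : ℂ => J (b + s • u + t • v))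
    hr (DifferentiableOn.diffContOnCl fun s hs => (hdt s
      (closure_ball_subset_closedBall hs)).differentiableWithinAt) h1 h2
  exact ⟨s, (hST (mk_mem_prod (hRS s (ball_subset_ball hrR.le hs)).2 ht)).2, hJs⟩

/-- Near a suitable zero the zero set of `J` contains a Lipschitz curve that is transverse to `u`,
and it can be found in each neighbourhood of this zero. -/
theorem exists_lipschitz_curve_of_zeros [FiniteDimensional ℂ E] {J : E → ℂ} {U : Set E}
    (hU : IsOpen U) (hJ : DifferentiableOn ℂ J U) {a u : E} (v : E) (ha : a ∈ U) (hJa : J a = 0)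
    (hne : ∃ᶠ s in 𝓝 (0 : ℂ), J (a + s • u) ≠ 0) :
    ∃ b ∈ U, ∀ W ∈ 𝓝 b, ∃ ρ > 0, ∃ C : ℝ, ∃ s : ℂ → ℂ, ∀ t ∈ ball (0 : ℂ) ρ,
      b + s t • u + t • v ∈ W ∧ J (b + s t • u + t • v) = 0 ∧
        ∀ t' ∈ ball (0 : ℂ) ρ, ‖s t - s t'‖ ≤ C * ‖t - t'‖ := by
  obtain ⟨b, hbU, hJb, hbne, ψ, hψ, hψ0, hψu⟩ := exists_regular_zero hU hJ ha hJa hne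
  refine ⟨b, hbU, fun W hW => ?_⟩
  set α := fderiv ℂ ψ b u with hα
  set β := fderiv ℂ ψ b v with hβ
  have hα0 : 0 < ‖α‖ := norm_pos_iff.2 hψu
  set c : ℝ := ‖α‖ / (2 * (‖u‖ + 1)) with hc
  have hc0 : 0 < c := by positivity
  have hcu : c * ‖u‖ ≤ ‖α‖ / 2 := by
    rw [hc, div_mul_eq_mul_div, div_le_div_iff₀ (by positivity) two_pos]
    nlinarith [norm_nonneg u]
  have hstrict := (hasStrictFDerivAt_of_differentiableOn hU hψ hbU).isLittleO.def hc0
  rw [nhds_prod_eq] at hstrict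
  obtain ⟨V, hV, hVp⟩ := eventually_prod_self_iff'.1 hstrict
  obtain ⟨ρ, hρ, hroot⟩ := Metric.eventually_nhds_iff_ball.1
    (exists_zero_on_parallel_lines hU hJ v hbU hJb hbne
      (inter_mem (inter_mem hW hV) (hU.mem_nhds hbU)))
  choose! s hsW hs0 using hroot
  refine ⟨ρ, hρ, 2 * (‖β‖ + c * ‖v‖) / ‖α‖, s, fun t ht => ⟨(hsW t ht).1.1, hs0 t ht, ?_⟩⟩
  intro t' ht'
  have h1 := hVp _ (hsW t ht).1.2 _ (hsW t' ht').1.2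
  simp only at h1
  rw [hψ0 _ (hsW t ht).2 (hs0 t ht), hψ0 _ (hsW t' ht').2 (hs0 t' ht')] at h1
  have h2 : b + s t • u + t • v - (b + s t' • u + t' • v) =
      (s t - s t') • u + (t - t') • v := by module
  rw [h2, map_add, map_smul, map_smul, ← hα, ← hβ, sub_zero, zero_sub, norm_neg] at h1
  have h3 : ‖(s t - s t') • u + (t - t') • v‖ ≤ ‖s t - s t'‖ * ‖u‖ + ‖t - t'‖ * ‖v‖ := by
    refine (norm_add_le _ _).trans (le_of_eq ?_)
    rw [norm_smul, norm_smul]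
  have h4 : ‖s t - s t'‖ * ‖α‖ ≤
      ‖(s t - s t') • α + (t - t') • β‖ + ‖t - t'‖ * ‖β‖ := by
    have h5 := norm_sub_le ((s t - s t') • α + (t - t') • β) ((t - t') • β)
    rw [add_sub_cancel_right, norm_smul, norm_smul] at h5
    exact h5
  have h6 := mul_le_mul_of_nonneg_left h3 hc0.le
  have h7 := mul_le_mul_of_nonneg_left hcu (norm_nonneg (s t - s t'))
  rw [div_mul_eq_mul_div, le_div_iff₀ hα0]
  nlinarith

end Zeros

/-! ### Singular points of injective holomorphic maps -/

section Injective

open Metric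

/-- In one variable the inverse of an injective holomorphic function is continuous, hence
holomorphic by the removable singularity theorem. -/
theorem deriv_ne_zero_of_injOn {f : ℂ → ℂ} {U : Set ℂ} (hU : IsOpen U)
    (hf : DifferentiableOn ℂ f U) (hinj : InjOn f U) {a : ℂ} (ha : a ∈ U) : deriv f a ≠ 0 := by
  intro hda
  have hana : ∀ z ∈ U, AnalyticAt ℂ f z := fun z hz => hf.analyticAt (hU.mem_nhds hz)
  -- an injective function is not locally constant
  have hconst : ∀ z ∈ U, ∀ c, ¬ ∀ᶠ w in 𝓝 z, f w = c := by
    intro z hz c hev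
    have h1 : ∀ᶠ w in 𝓝[≠] z, w ∈ U ∧ f w = c :=
      nhdsWithin_le_nhds ((hU.eventually_mem hz).and hev)
    obtain ⟨w, ⟨hwU, hw⟩, hwz⟩ := (h1.and self_mem_nhdsWithin).exists
    exact hwz (hinj hwU hz (hw.trans hev.self_of_nhds.symm))
  have hopen : ∀ z ∈ U, 𝓝 (f z) ≤ map f (𝓝 z) := fun z hz =>
    ((hana z hz).eventually_constant_or_nhds_le_map_nhds).resolve_left (hconst z hz (f z))
  let g := Function.invFunOn f U
  have hgf : ∀ z ∈ U, g (f z) = z := fun z hz => hinj.leftInvOn_invFunOn hz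
  have hgc : ∀ z ∈ U, Tendsto g (𝓝 (f z)) (𝓝 z) := by
    intro z hz
    refine Tendsto.mono_left ?_ (hopen z hz)
    rw [tendsto_map'_iff]
    refine tendsto_id.congr' ?_
    filter_upwards [hU.mem_nhds hz] with w hw using (hgf w hw).symm
  have hfg : ∀ᶠ w in 𝓝 (f a), f (g w) = w ∧ g w ∈ U := by
    refine hopen a ha ?_
    rw [mem_map]
    filter_upwards [hU.mem_nhds ha] with z hz
    rw [mem_preimage, mem_ofPred_eq, hgf z hz]
    exact ⟨rfl, hz⟩
  have hd_ne : ∀ᶠ z in 𝓝[≠] a, deriv f z ≠ 0 := by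
    refine ((hana a ha).deriv.eventually_eq_zero_or_eventually_ne_zero).resolve_left fun h => ?_
    obtain ⟨r, hr, hrU⟩ := Metric.eventually_nhds_iff_ball.1 ((hU.eventually_mem ha).and h)
    refine hconst a ha (f a) ?_
    filter_upwards [ball_mem_nhds a hr] with z hz
    exact isOpen_ball.is_const_of_deriv_eq_zero (convex_ball a r).isPreconnected
      (hf.mono fun w hw => (hrU w hw).1) (fun w hw => (hrU w hw).2) hz (mem_ball_self hr)
  have hgd : ∀ᶠ w in 𝓝[≠] (f a), DifferentiableAt ℂ g w := by
    rw [eventually_nhdsWithin_iff] at hd_ne ⊢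
    filter_upwards [hfg.eventually_nhds, (hgc a ha).eventually hd_ne] with w hw hne hwa
    have hgw := hw.self_of_nhds
    have h1 : g w ≠ a := fun h => hwa (by rw [mem_singleton_iff, ← hgw.1, h])
    have h2 : HasDerivAt f (deriv f (g w)) (g w) :=
      (hf.differentiableAt (hU.mem_nhds hgw.2)).hasDerivAt
    have h3 : ContinuousAt g w := by
      have := hgc (g w) hgw.2
      rw [hgw.1] at this
      exact this
    exact (h2.of_local_left_inverse h3 (hne h1) (hw.mono fun _ h => h.1)).differentiableAt
  have hga : AnalyticAt ℂ g (f a) := by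
    refine Complex.analyticAt_of_differentiable_on_punctured_nhds_of_continuousAt hgd ?_
    have := hgc a ha
    rw [ContinuousAt, hgf a ha]
    exact this
  have hchain := (hga.differentiableAt.hasDerivAt).comp a
    (hf.differentiableAt (hU.mem_nhds ha)).hasDerivAt
  have hid : (g ∘ f) =ᶠ[𝓝 a] id := by
    filter_upwards [hU.mem_nhds ha] with z hz using hgf z hz
  have h1 := (hasDerivAt_id a).unique (hchain.congr_of_eventuallyEq hid.symm)
  rw [hda, mul_zero] at h1
  exact one_ne_zero h1

theorem differentiableOn_det {E G : Type*} [NormedAddCommGroup E] [NormedSpace ℂ E]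
    [NormedAddCommGroup G] [NormedSpace ℂ G] [FiniteDimensional ℂ G] {A : E → (G →L[ℂ] G)}
    {U : Set E} (hA : DifferentiableOn ℂ A U) : DifferentiableOn ℂ (fun z => (A z).det) U := by
  classical
  let b := Module.finBasis ℂ G
  have h1 : (fun z => (A z).det) = fun z => ∑ σ : Equiv.Perm (Fin (Module.finrank ℂ G)),
      ((Equiv.Perm.sign σ : ℤ) : ℂ) * ∏ i,
        LinearMap.toContinuousLinearMap (b.coord (σ i)) (A z (b i)) := by
    funext z
    change LinearMap.det (A z : G →ₗ[ℂ] G) = _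
    rw [← LinearMap.det_toMatrix b, Matrix.det_apply']
    simp [LinearMap.toMatrix_apply]
  rw [h1]
  refine DifferentiableOn.fun_sum fun σ _ => DifferentiableOn.const_mul ?_ _
  rw [← Finset.prod_fn]
  refine Finset.prod_induction _ (fun k : E → ℂ => DifferentiableOn ℂ k U)
    (fun _ _ hk hl => hk.mul hl) (differentiableOn_const 1) fun i _ => ?_
  exact (ContinuousLinearMap.differentiable _).comp_differentiableOn
    (hA.clm_apply (differentiableOn_const _))

theorem injective_iff_det_ne_zero {G : Type*} [NormedAddCommGroup G] [NormedSpace ℂ G]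
    [FiniteDimensional ℂ G] (A : G →L[ℂ] G) : Function.Injective A ↔ A.det ≠ 0 := by
  have h1 : A.det = LinearMap.det (A : G →ₗ[ℂ] G) := rfl
  rw [h1, ← isUnit_iff_ne_zero, ← LinearMap.isUnit_iff_isUnit_det,
    LinearMap.isUnit_iff_ker_eq_bot, LinearMap.ker_eq_bot]
  rfl

variable {E F : Type*} [NormedAddCommGroup E] [NormedSpace ℂ E] [FiniteDimensional ℂ E]
  [NormedAddCommGroup F] [NormedSpace ℂ F] [FiniteDimensional ℂ F]

theorem eqOn_ball_of_eventually_zero_on_lines {E : Type*} [NormedAddCommGroup E]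
    [NormedSpace ℂ E] {J : E → ℂ} {a : E} {r : ℝ}
    (hJ : DifferentiableOn ℂ J (ball a r))
    (hev : ∀ u : E, ∀ᶠ s in 𝓝 (0 : ℂ), J (a + s • u) = 0) : ∀ z ∈ ball a r, J z = 0 := by
  intro z hz
  set u := z - a with hu
  have hr : 0 < r := pos_of_mem_ball hz
  let S : Set ℂ := (fun s : ℂ => a + s • u) ⁻¹' ball a r
  have hSo : IsOpen S := isOpen_ball.preimage (by fun_prop)
  have hSc : IsPreconnected S := by
    have : S = ((LinearMap.toSpanSingleton ℂ E u).restrictScalars ℝ) ⁻¹' ball 0 r := by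
      ext s
      simp [S]
    rw [this]
    exact ((convex_ball 0 r).linear_preimage _).isPreconnected
  have hana : AnalyticOnNhd ℂ (fun s : ℂ => J (a + s • u)) S := by
    refine DifferentiableOn.analyticOnNhd (fun s hs => ?_) hSo
    exact (hasDerivAt_comp_line (hJ.differentiableAt
      (isOpen_ball.mem_nhds hs))).differentiableAt.differentiableWithinAt
  have h0 : (0 : ℂ) ∈ S := by simp [S, hr]
  have h1 : (1 : ℂ) ∈ S := by simpa [S, hu] using hz
  have := hana.eqOn_zero_of_preconnected_of_eventuallyEq_zero hSc h0 (hev u) h1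
  simpa [hu] using this

/-- A holomorphic map in at least two variables is not injective if its derivative vanishes at each
point at which it is singular, and such points exist: it would be constant along a curve of
singular points. -/
theorem not_injOn_of_fderiv_eq_zero {f : E → F} {U : Set E} (hU : IsOpen U)
    (hf : DifferentiableOn ℂ f U) (hdim : Module.finrank ℂ E = Module.finrank ℂ F)
    (h2 : 2 ≤ Module.finrank ℂ E)
    (hsing : ∀ z ∈ U, ¬ Function.Injective (fderiv ℂ f z) → fderiv ℂ f z = 0)
    {a : E} (ha : a ∈ U) (hfa : fderiv ℂ f a = 0) : ¬ InjOn f U := by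
  intro hinj
  have : Nontrivial E := Module.nontrivial_of_finrank_pos (R := ℂ) (by omega)
  let L : F ≃L[ℂ] E := ContinuousLinearEquiv.ofFinrankEq hdim.symm
  let J : E → ℂ := fun z => ((L : F →L[ℂ] E).comp (fderiv ℂ f z)).det
  have hJ : DifferentiableOn ℂ J U := differentiableOn_det fun z hz =>
    (ContinuousLinearMap.compL ℂ E F E
      (L : F →L[ℂ] E)).differentiableAt.comp_differentiableWithinAt z
        (differentiableOn_fderiv hU hf z hz)
  have hJ0 : ∀ z ∈ U, J z = 0 → fderiv ℂ f z = 0 := by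
    intro z hz hJz
    refine hsing z hz fun hcon => ?_
    exact (injective_iff_det_ne_zero _).1 (L.injective.comp hcon :
      Function.Injective ((L : F →L[ℂ] E).comp (fderiv ℂ f z))) hJz
  have hJa : J a = 0 := by
    by_contra hcon
    obtain ⟨x, hx⟩ := exists_ne (0 : E)
    have := (injective_iff_det_ne_zero ((L : F →L[ℂ] E).comp (fderiv ℂ f a))).2 hcon
    rw [hfa] at this
    exact hx (this (by simp))
  -- the function `J` is not zero on some complex line through `a`
  obtain ⟨u, hu⟩ : ∃ u : E, ∃ᶠ s in 𝓝 (0 : ℂ), J (a + s • u) ≠ 0 := by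
    by_contra! hev
    obtain ⟨r, hr, hrU⟩ := Metric.mem_nhds_iff.1 (hU.mem_nhds ha)
    have hzero := eqOn_ball_of_eventually_zero_on_lines (hJ.mono hrU) hev
    have hcst : ∀ z ∈ ball a r, f z = f a := fun z hz =>
      isOpen_ball.is_const_of_fderiv_eq_zero (convex_ball a r).isPreconnected (hf.mono hrU)
        (fun w hw => hJ0 w (hrU hw) (hzero w hw)) hz (mem_ball_self hr)
    obtain ⟨x, hx⟩ := exists_ne (0 : E)
    have hev2 : ∀ᶠ s in 𝓝[≠] (0 : ℂ), a + s • x ∈ ball a r :=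
      nhdsWithin_le_nhds ((tendsto_line a x).eventually (ball_mem_nhds a hr))
    obtain ⟨s, hs, hs0⟩ := (hev2.and self_mem_nhdsWithin).exists
    have := hinj (hrU hs) ha (hcst _ hs)
    rw [add_eq_left, smul_eq_zero] at this
    exact this.elim hs0 hx
  obtain ⟨v, hv⟩ : ∃ v : E, v ∉ Submodule.span ℂ {u} := by
    by_contra! hcon
    have h1 : Submodule.span ℂ {u} = ⊤ := by
      rw [Submodule.eq_top_iff']
      exact hcon
    have h3 := finrank_span_le_card (R := ℂ) ({u} : Set E)
    rw [h1, finrank_top] at h3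
    simp at h3
    omega
  obtain ⟨b, hbU, hcurve⟩ := exists_lipschitz_curve_of_zeros hU hJ v ha hJa hu
  obtain ⟨r, hr, hrU, M, hM⟩ := exists_norm_le_ball_of_differentiableOn hU hf hbU
  have hM0 : 0 ≤ M := (norm_nonneg _).trans (hM b (mem_ball_self (by linarith)))
  obtain ⟨ρ, hρ, C, s, hs⟩ := hcurve _ (ball_mem_nhds b hr)
  set z : ℂ → E := fun t => b + s t • u + t • v with hz
  have hzU : ∀ t ∈ ball (0 : ℂ) ρ, z t ∈ U := fun t ht =>
    hrU (ball_subset_ball (by linarith) (hs t ht).1)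
  have hlip : ∀ t ∈ ball (0 : ℂ) ρ, ∀ t' ∈ ball (0 : ℂ) ρ,
      ‖z t' - z t‖ ≤ (C * ‖u‖ + ‖v‖) * ‖t' - t‖ := by
    intro t ht t' ht'
    have h1 : z t' - z t = (s t' - s t) • u + (t' - t) • v := by simp only [hz]; module
    rw [h1]
    refine (norm_add_le _ _).trans ?_
    rw [norm_smul, norm_smul]
    have := mul_le_mul_of_nonneg_right ((hs t' ht').2.2 t ht) (norm_nonneg u)
    linarith
  -- as the derivative vanishes along the curve, `f` is constant on it
  have hder : ∀ t ∈ ball (0 : ℂ) ρ, HasDerivAt (fun t => f (z t)) 0 t := by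
    intro t ht
    rw [hasDerivAt_iff_isLittleO]
    have h1 : (fun t' => f (z t') - f (z t) - (t' - t) • (0 : F)) =O[𝓝 t]
        fun t' => ‖t' - t‖ * ‖t' - t‖ := by
      refine Asymptotics.IsBigO.of_bound (2 * M / r ^ 2 * (C * ‖u‖ + ‖v‖) ^ 2) ?_
      filter_upwards [isOpen_ball.mem_nhds ht] with t' ht'
      have h3 := norm_sub_sub_fderiv_le_of_norm_le hr (hf.mono hrU) hM (hs t' ht').1 (hs t ht).1
      rw [show fderiv ℂ f (b + s t • u + t • v) = 0 from hJ0 _ (hzU t ht) (hs t ht).2.1,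
        _root_.zero_apply, sub_zero] at h3
      rw [smul_zero, sub_zero, norm_mul, norm_norm]
      refine h3.trans ?_
      have h4 := hlip t ht t' ht'
      calc 2 * M / r ^ 2 * ‖z t' - z t‖ * ‖z t' - z t‖
          = 2 * M / r ^ 2 * (‖z t' - z t‖ ^ 2) := by ring
        _ ≤ 2 * M / r ^ 2 * (((C * ‖u‖ + ‖v‖) * ‖t' - t‖) ^ 2) := by gcongr
        _ = _ := by ring
    refine h1.trans_isLittleO ?_
    have h3 : (fun t' => ‖t' - t‖) =o[𝓝 t] fun _ => (1 : ℝ) := by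
      rw [Asymptotics.isLittleO_one_iff]
      have : Continuous fun t' : ℂ => ‖t' - t‖ := by fun_prop
      simpa using this.tendsto t
    simpa using
      (h3.mul_isBigO (Asymptotics.isBigO_refl (fun t' : ℂ => ‖t' - t‖) (𝓝 t))).norm_right
  have h0 : (0 : ℂ) ∈ ball (0 : ℂ) ρ := mem_ball_self hρ
  have h1 : ((ρ / 2 : ℝ) : ℂ) ∈ ball (0 : ℂ) ρ := by
    rw [mem_ball_zero_iff, Complex.norm_real, Real.norm_of_nonneg (by positivity)]
    linarith
  have hfeq : f (z (ρ / 2 : ℝ)) = f (z 0) :=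
    isOpen_ball.is_const_of_deriv_eq_zero (convex_ball (0 : ℂ) ρ).isPreconnected
      (fun t ht => (hder t ht).differentiableAt.differentiableWithinAt)
      (fun t ht => (hder t ht).deriv) h1 h0
  have hzeq := hinj (hzU _ h1) (hzU _ h0) hfeq
  have hρ0 : ((ρ / 2 : ℝ) : ℂ) ≠ 0 := by
    rw [Complex.ofReal_ne_zero]
    positivity
  refine hv (Submodule.mem_span_singleton.2 ⟨((ρ / 2 : ℝ) : ℂ)⁻¹ * (s 0 - s (ρ / 2 : ℝ)), ?_⟩)
  have h5 : (s 0 - s (ρ / 2 : ℝ)) • u = ((ρ / 2 : ℝ) : ℂ) • v := by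
    have : z (ρ / 2 : ℝ) - z 0 = 0 := sub_eq_zero.2 hzeq
    have h6 : (s 0 - s (ρ / 2 : ℝ)) • u = ((ρ / 2 : ℝ) : ℂ) • v - (z (ρ / 2 : ℝ) - z 0) := by
      simp only [hz]; module
    rw [h6, this, sub_zero]
  rw [mul_smul, h5, smul_smul, inv_mul_cancel₀ hρ0, one_smul]

end Injective

/-! ### Osgood's theorem -/

section Osgood

open Metric

universe u

variable {E F : Type u} [NormedAddCommGroup E] [NormedSpace ℂ E] [FiniteDimensional ℂ E]
  [NormedAddCommGroup F] [NormedSpace ℂ F] [FiniteDimensional ℂ F]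

theorem exists_continuousLinearMap_leftInverse_subtype (S : Submodule ℂ E) :
    ∃ P : E →L[ℂ] S, ∀ x : S, P x = x := by
  obtain ⟨P, hP⟩ := LinearMap.exists_leftInverse_of_injective S.subtype S.ker_subtype
  exact ⟨LinearMap.toContinuousLinearMap P, fun x => LinearMap.congr_fun hP x⟩

theorem finrank_ker_add_one (l : E →L[ℂ] ℂ) (hl : l ≠ 0) :
    Module.finrank ℂ (LinearMap.ker (l : E →ₗ[ℂ] ℂ)) + 1 = Module.finrank ℂ E := by
  have h1 := LinearMap.finrank_range_add_finrank_ker (l : E →ₗ[ℂ] ℂ)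
  have h2 : LinearMap.range (l : E →ₗ[ℂ] ℂ) = ⊤ := by
    refine LinearMap.range_eq_top.2 (LinearMap.surjective fun h => hl ?_)
    ext x
    exact LinearMap.congr_fun h x
  rw [h2, finrank_top, Module.finrank_self] at h1
  omega

/-- If the derivative of an injective holomorphic map `f` is not zero at `a`, then the restriction
of `f` to a level set of a linear functional of `f` is an injective holomorphic map `k` in one
variable less, and the kernel of the derivative of `f` at `a` consists of vectors that are killed by
the derivative of `k`. -/
theorem exists_level_set_restriction {f : E → F} {U : Set E} (hU : IsOpen U)
    (hf : DifferentiableOn ℂ f U) (hinj : InjOn f U) {a : E} (ha : a ∈ U)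
    (hfa : fderiv ℂ f a ≠ 0) :
    ∃ (E₀ : Submodule ℂ E) (F₀ : Submodule ℂ F),
      Module.finrank ℂ E₀ + 1 = Module.finrank ℂ E ∧
      Module.finrank ℂ F₀ + 1 = Module.finrank ℂ F ∧
      ∃ (k : E₀ → F₀) (V : Set E₀), IsOpen V ∧ 0 ∈ V ∧ DifferentiableOn ℂ k V ∧ InjOn k V ∧
        ∀ x, fderiv ℂ f a x = 0 → ∃ x₀ : E₀, (x₀ : E) = x ∧ fderiv ℂ k 0 x₀ = 0 := by
  obtain ⟨x₁, hx₁⟩ : ∃ x₁, fderiv ℂ f a x₁ ≠ 0 := by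
    by_contra! h
    exact hfa (ContinuousLinearMap.ext h)
  obtain ⟨l, hl⟩ := SeparatingDual.exists_ne_zero (R := ℂ) hx₁
  set lam : E →L[ℂ] ℂ := l.comp (fderiv ℂ f a) with hlam
  have hl0 : l ≠ 0 := fun h => hl (by rw [h]; rfl)
  have hlam0 : lam ≠ 0 := fun h => hl (congrArg (fun m : E →L[ℂ] ℂ => m x₁) h)
  set E₀ := LinearMap.ker (lam : E →ₗ[ℂ] ℂ) with hE₀
  set F₀ := LinearMap.ker (l : F →ₗ[ℂ] ℂ) with hF₀
  obtain ⟨P, hP⟩ := exists_continuousLinearMap_leftInverse_subtype E₀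
  obtain ⟨Q, hQ⟩ := exists_continuousLinearMap_leftInverse_subtype F₀
  have hrE : Module.finrank ℂ E₀ + 1 = Module.finrank ℂ E := finrank_ker_add_one lam hlam0
  -- the chart `Φ` has `l ∘ f` as first coordinate
  set Φ : E → ℂ × E₀ := fun z => (l (f z), P z) with hΦ
  have hA_inj : Function.Injective (lam.prod P : E →ₗ[ℂ] ℂ × E₀) := by
    rw [← LinearMap.ker_eq_bot, LinearMap.ker_eq_bot']
    intro x hx
    have h1 : lam x = 0 := congrArg Prod.fst hx
    have h2 : P x = 0 := congrArg Prod.snd hx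
    have h3 := hP ⟨x, h1⟩
    rw [h2] at h3
    exact (congrArg Subtype.val h3).symm
  let A : E ≃L[ℂ] ℂ × E₀ := (LinearEquiv.ofInjectiveOfFinrankEq _ hA_inj (by
    rw [Module.finrank_prod, Module.finrank_self]; omega)).toContinuousLinearEquiv
  have hA : ∀ x, A x = (lam x, P x) := fun x => rfl
  have hΦd : DifferentiableOn ℂ Φ U :=
    (l.differentiable.comp_differentiableOn hf).prodMk P.differentiable.differentiableOn
  have hΦa : HasFDerivAt Φ (A : E →L[ℂ] ℂ × E₀) a := by
    have h1 : (A : E →L[ℂ] ℂ × E₀) = (l.comp (fderiv ℂ f a)).prod P := rfl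
    rw [h1]
    exact (l.hasFDerivAt.comp a (hf.differentiableAt (hU.mem_nhds ha)).hasFDerivAt).prodMk
      P.hasFDerivAt
  have hΦc : ContDiffAt ℂ 1 Φ a :=
    (contDiffOn_one_of_differentiableOn hU hΦd).contDiffAt (hU.mem_nhds ha)
  have hΦs := hΦc.hasStrictFDerivAt' hΦa one_ne_zero
  set χ : ℂ × E₀ → E := hΦs.localInverse Φ A a with hχ
  have hχc : ContDiffAt ℂ 1 χ (Φ a) := hΦc.to_localInverse hΦa one_ne_zero
  have hχd : ∀ᶠ y in 𝓝 (Φ a), DifferentiableAt ℂ χ y :=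
    (hχc.eventually (by simp)).mono fun y hy => hy.differentiableAt one_ne_zero
  have hχU : ∀ᶠ y in 𝓝 (Φ a), χ y ∈ U :=
    hΦs.localInverse_tendsto.eventually (hU.eventually_mem ha)
  -- the level set is parametrized by `σ`
  set c := l (f a) with hc
  let τ : E₀ → ℂ × E₀ := fun t => (c, P a + t)
  have hτd : ∀ t, HasFDerivAt τ (ContinuousLinearMap.inr ℂ ℂ E₀) t := by
    intro t
    have h1 : HasFDerivAt (fun t : E₀ => P a + t) (ContinuousLinearMap.id ℂ E₀) t :=
      (hasFDerivAt_id t).const_add (P a)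
    exact (hasFDerivAt_const c t).prodMk h1
  have hτ0 : τ 0 = Φ a := by simp [τ, hΦ, hc]
  have hτt : Tendsto τ (𝓝 0) (𝓝 (Φ a)) := by
    rw [← hτ0]
    exact (hτd 0).continuousAt
  obtain ⟨r, hr, hball⟩ := Metric.eventually_nhds_iff_ball.1
    (hτt.eventually (hχd.and (hχU.and hΦs.eventually_right_inverse)))
  have hlev : ∀ t ∈ ball (0 : E₀) r, l (f (χ (τ t))) = c ∧ P (χ (τ t)) = P a + t := by
    intro t ht
    have := (hball t ht).2.2
    exact ⟨congrArg Prod.fst this, congrArg Prod.snd this⟩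
  have hσd : ∀ t ∈ ball (0 : E₀) r, DifferentiableAt ℂ (fun t => f (χ (τ t)) - f a) t := by
    intro t ht
    have h1 : DifferentiableAt ℂ (fun t => χ (τ t)) t :=
      (hball t ht).1.comp t (hτd t).differentiableAt
    exact ((hf.differentiableAt (hU.mem_nhds (hball t ht).2.1)).comp t h1).sub_const _
  refine ⟨E₀, F₀, hrE, finrank_ker_add_one l hl0, fun t => Q (f (χ (τ t)) - f a), ball 0 r,
    isOpen_ball, mem_ball_self hr, fun t ht =>
      (Q.differentiableAt.comp t (hσd t ht)).differentiableWithinAt, ?_, ?_⟩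
  · intro t ht t' ht' heq
    have hval : ∀ t ∈ ball (0 : E₀) r, ((Q (f (χ (τ t)) - f a) : F₀) : F) = f (χ (τ t)) - f a := by
      intro t ht
      have h1 : f (χ (τ t)) - f a ∈ F₀ := by
        rw [hF₀, LinearMap.mem_ker]
        change l (f (χ (τ t)) - f a) = 0
        rw [map_sub, (hlev t ht).1, hc, sub_self]
      exact congrArg Subtype.val (hQ ⟨_, h1⟩)
    have h1 : f (χ (τ t)) = f (χ (τ t')) := by
      have := congrArg Subtype.val heq
      simp only at this
      rw [hval t ht, hval t' ht'] at this
      exact sub_left_injective this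
    have h2 := hinj (hball t ht).2.1 (hball t' ht').2.1 h1
    have h3 := (hlev t ht).2
    rw [h2, (hlev t' ht').2] at h3
    exact (add_left_cancel h3).symm
  · intro x hx
    have hxE : x ∈ E₀ := by
      rw [hE₀, LinearMap.mem_ker]
      change l (fderiv ℂ f a x) = 0
      rw [hx, map_zero]
    refine ⟨⟨x, hxE⟩, rfl, ?_⟩
    have hχ' : HasFDerivAt χ (A.symm : ℂ × E₀ →L[ℂ] E) (τ 0) := by
      rw [hτ0]
      exact hΦs.to_localInverse.hasFDerivAt
    have hχτ : χ (τ 0) = a := by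
      rw [hτ0]
      exact hΦs.localInverse_apply_image
    have hf' : HasFDerivAt f (fderiv ℂ f a) (χ (τ 0)) := by
      rw [hχτ]
      exact (hf.differentiableAt (hU.mem_nhds ha)).hasFDerivAt
    have hk := Q.hasFDerivAt.comp (0 : E₀)
      ((hf'.comp (0 : E₀) (hχ'.comp (0 : E₀) (hτd 0))).sub_const (f a))
    have hk' : fderiv ℂ (fun t => Q (f (χ (τ t)) - f a)) 0 = _ := hk.fderiv
    rw [hk']
    have h1 : A.symm (0, ⟨x, hxE⟩) = x := by
      rw [ContinuousLinearEquiv.symm_apply_eq, hA]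
      refine Prod.ext ?_ ?_
      · exact (LinearMap.mem_ker.1 hxE).symm
      · exact (hP ⟨x, hxE⟩).symm
    change Q (fderiv ℂ f a (A.symm (0, ⟨x, hxE⟩))) = 0
    rw [h1, hx, map_zero]

theorem fderiv_ne_zero_of_finrank_eq_one {f : E → F} {U : Set E} (hU : IsOpen U)
    (hf : DifferentiableOn ℂ f U) (hinj : InjOn f U) (hE : Module.finrank ℂ E = 1)
    (hF : Module.finrank ℂ F = 1) {a : E} (ha : a ∈ U) : fderiv ℂ f a ≠ 0 := by
  intro h0
  let e : ℂ ≃L[ℂ] E := ContinuousLinearEquiv.ofFinrankEq (by rw [Module.finrank_self, hE])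
  let e' : F ≃L[ℂ] ℂ := ContinuousLinearEquiv.ofFinrankEq (by rw [Module.finrank_self, hF])
  have hd : ∀ s ∈ e ⁻¹' U, HasFDerivAt (fun s => e' (f (e s)))
      ((e' : F →L[ℂ] ℂ).comp ((fderiv ℂ f (e s)).comp (e : ℂ →L[ℂ] E))) s := fun s hs =>
    e'.hasFDerivAt.comp s
      ((hf.differentiableAt (hU.mem_nhds hs)).hasFDerivAt.comp s e.hasFDerivAt)
  have hmem : e.symm a ∈ e ⁻¹' U := by simpa using ha
  refine deriv_ne_zero_of_injOn (f := fun s => e' (f (e s))) (hU.preimage e.continuous)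
    (fun s hs => (hd s hs).differentiableAt.differentiableWithinAt)
    (fun s hs t ht hst => e.injective (hinj hs ht (e'.injective hst))) hmem ?_
  rw [(hd _ hmem).hasDerivAt.deriv]
  simp [h0]

/-- **Osgood's theorem**: the derivative of an injective holomorphic map between spaces of the same
dimension is invertible. -/
theorem injective_fderiv_of_injOn {f : E → F} {U : Set E} (hU : IsOpen U)
    (hf : DifferentiableOn ℂ f U) (hdim : Module.finrank ℂ E = Module.finrank ℂ F)
    (hinj : InjOn f U) {a : E} (ha : a ∈ U) : Function.Injective (fderiv ℂ f a) := by
  induction hn : Module.finrank ℂ E generalizing E F with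
  | zero =>
    have := Module.finrank_zero_iff.1 hn
    exact Function.injective_of_subsingleton _
  | succ n ih =>
    have hregular : ∀ z ∈ U, fderiv ℂ f z ≠ 0 → Function.Injective (fderiv ℂ f z) := by
      intro z hz hfz
      obtain ⟨E₀, F₀, hE₀, hF₀, k, V, hV, h0V, hkV, hkinj, hker⟩ :=
        exists_level_set_restriction hU hf hinj hz hfz
      rw [injective_iff_map_eq_zero]
      intro x hx
      obtain ⟨x₀, rfl, hx₀⟩ := hker x hx
      have hk := ih hV hkV (by omega) hkinj h0V (by omega)
      rw [injective_iff_map_eq_zero] at hk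
      rw [hk x₀ hx₀]
      rfl
    by_contra hcon
    have hfa : fderiv ℂ f a = 0 := by
      by_contra h
      exact hcon (hregular a ha h)
    rcases Nat.eq_zero_or_pos n with rfl | hpos
    · exact fderiv_ne_zero_of_finrank_eq_one hU hf hinj hn (hdim ▸ hn) ha hfa
    · refine not_injOn_of_fderiv_eq_zero hU hf hdim (by omega) (fun z hz h => ?_) ha hfa hinj
      by_contra h'
      exact h (hregular z hz h')

theorem exists_hasStrictFDerivAt_equiv_of_injOn {f : E → F} {U : Set E} (hU : IsOpen U)
    (hf : DifferentiableOn ℂ f U) (hdim : Module.finrank ℂ E = Module.finrank ℂ F)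
    (hinj : InjOn f U) {a : E} (ha : a ∈ U) :
    ∃ A : E ≃L[ℂ] F, HasStrictFDerivAt f (A : E →L[ℂ] F) a := by
  refine ⟨(LinearEquiv.ofInjectiveOfFinrankEq (fderiv ℂ f a : E →ₗ[ℂ] F)
    (injective_fderiv_of_injOn hU hf hdim hinj ha) hdim).toContinuousLinearEquiv, ?_⟩
  exact hasStrictFDerivAt_of_differentiableOn hU hf ha

theorem differentiableOn_leftInverse_of_injOn {f : E → F} {U : Set E} (hU : IsOpen U)
    (hf : DifferentiableOn ℂ f U) (hdim : Module.finrank ℂ E = Module.finrank ℂ F)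
    {h : F → E} (hh : LeftInvOn h f U) : DifferentiableOn ℂ h (f '' U) := by
  rintro _ ⟨x, hx, rfl⟩
  obtain ⟨A, hA⟩ := exists_hasStrictFDerivAt_equiv_of_injOn hU hf hdim hh.injOn hx
  refine (hA.to_local_left_inverse ?_).hasFDerivAt.differentiableAt.differentiableWithinAt
  filter_upwards [hU.mem_nhds hx] with y hy using hh hy

end Osgood

/-! ### Limits of injective holomorphic maps -/

section Limits

open Metric

/-- **Hurwitz's theorem** for continuous convergence along a filter. -/
theorem ne_zero_of_tendsto_of_forall_ne_zero {ι : Type*} {l : Filter ι} [l.NeBot] {S : Set ℂ}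
    (hS : IsOpen S) (hSc : IsPreconnected S) {v : ι → ℂ → ℂ} {w : ℂ → ℂ}
    (hw : DifferentiableOn ℂ w S)
    (hv : ∀ᶠ i in l, DifferentiableOn ℂ (v i) S ∧ ∀ s ∈ S, v i s ≠ 0)
    (hlim : ∀ s ∈ S, Tendsto (fun q : ι × ℂ => v q.1 q.2) (l ×ˢ 𝓝 s) (𝓝 (w s)))
    {s₀ s₁ : ℂ} (hs₀ : s₀ ∈ S) (hw₀ : w s₀ ≠ 0) (hs₁ : s₁ ∈ S) : w s₁ ≠ 0 := by
  intro hw₁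
  have hana : AnalyticOnNhd ℂ w S := hw.analyticOnNhd hS
  have hiso : ∀ᶠ s in 𝓝[≠] s₁, w s ≠ 0 :=
    ((hana s₁ hs₁).eventually_eq_zero_or_eventually_ne_zero).resolve_left fun h =>
      hw₀ (hana.eqOn_zero_of_preconnected_of_eventuallyEq_zero hSc hs₁ h hs₀)
  rw [eventually_nhdsWithin_iff] at hiso
  obtain ⟨R, hR, hRS⟩ := Metric.eventually_nhds_iff_ball.1 (hiso.and (hS.eventually_mem hs₁))
  obtain ⟨r, hr, hrR⟩ := exists_between hR
  have hsub : closedBall s₁ r ⊆ S := fun s hs => (hRS s (closedBall_subset_ball hrR hs)).2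
  obtain ⟨s₂, hs₂, hmin⟩ := (isCompact_sphere s₁ r).exists_isMinOn
    (NormedSpace.sphere_nonempty.2 hr.le) (f := fun s => ‖w s‖)
    (hw.continuousOn.mono (sphere_subset_closedBall.trans hsub)).norm
  have hm0 : 0 < ‖w s₂‖ := norm_pos_iff.2
    ((hRS s₂ (closedBall_subset_ball hrR (sphere_subset_closedBall hs₂))).1
      (ne_of_mem_sphere hs₂ hr.ne'))
  have hev1 : ∀ᶠ i in l, ∀ s ∈ sphere s₁ r, ‖w s₂‖ / 2 ≤ ‖v i s‖ := by
    have h1 : {q : ι × ℂ | ‖w s₂‖ / 2 ≤ ‖v q.1 q.2‖} ∈ l ×ˢ 𝓝ˢ (sphere s₁ r) := by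
      refine (isCompact_sphere s₁ r).mem_prod_nhdsSet_of_forall fun s hs => ?_
      have h2 : ‖w s₂‖ / 2 < ‖w s‖ := by
        have : ‖w s₂‖ ≤ ‖w s‖ := hmin hs
        linarith
      filter_upwards [(hlim s (hsub (sphere_subset_closedBall hs))).norm.eventually_const_lt h2]
        with q hq using hq.le
    obtain ⟨a, ha, b, hb, hab⟩ := mem_prod_iff.1 h1
    filter_upwards [ha] with i hi s hs
    exact hab (mk_mem_prod hi (subset_of_mem_nhdsSet hb hs))
  have hev2 : ∀ᶠ i in l, ‖v i s₁‖ < ‖w s₂‖ / 2 := by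
    have h1 := (hlim s₁ hs₁).comp (tendsto_id.prodMk (tendsto_const_nhds (x := s₁)))
    refine h1.norm.eventually_lt_const ?_
    rw [hw₁, norm_zero]
    positivity
  obtain ⟨i, hvi, h1, h2⟩ := (hv.and (hev1.and hev2)).exists
  obtain ⟨s, hs, hs0⟩ := exists_zero_of_norm_lt_on_sphere hr
    ((hvi.1.mono (closure_ball_subset_closedBall.trans hsub)).diffContOnCl) h1 h2
  exact hvi.2 s (hsub (ball_subset_closedBall hs)) hs0

universe u

variable {E F : Type u} [NormedAddCommGroup E] [NormedSpace ℂ E] [FiniteDimensional ℂ E]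
  [NormedAddCommGroup F] [NormedSpace ℂ F] [FiniteDimensional ℂ F]

/-- If injective holomorphic maps of a ball converge together with their derivatives and the
derivative of the limit is invertible at the centre, then it is invertible everywhere: this is
Hurwitz's theorem for its determinant on the complex lines through the centre. -/
theorem injective_fderiv_of_tendsto {ι : Type*} {l : Filter ι} [l.NeBot]
    (hdim : Module.finrank ℂ E = Module.finrank ℂ F) {r : ℝ} {f : ι → E → F} {g : E → F}
    (hf : ∀ᶠ i in l, DifferentiableOn ℂ (f i) (ball 0 r) ∧ InjOn (f i) (ball 0 r))
    (hg : DifferentiableOn ℂ g (ball 0 r))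
    (hlim : ∀ x ∈ ball (0 : E) r, Tendsto (fun q : ι × E => fderiv ℂ (f q.1) q.2) (l ×ˢ 𝓝 x)
      (𝓝 (fderiv ℂ g x)))
    (h0 : Function.Injective (fderiv ℂ g 0)) {x : E} (hx : x ∈ ball 0 r) :
    Function.Injective (fderiv ℂ g x) := by
  let L : F ≃L[ℂ] E := ContinuousLinearEquiv.ofFinrankEq hdim.symm
  let d : (E →L[ℂ] F) → ℂ := fun A => ((L : F →L[ℂ] E).comp A).det
  have hd : ∀ A : E →L[ℂ] F, d A ≠ 0 ↔ Function.Injective A := by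
    intro A
    rw [← injective_iff_det_ne_zero]
    exact ⟨fun h => Function.Injective.of_comp (f := L) h, fun h => L.injective.comp h⟩
  have hdd : Differentiable ℂ d := by
    rw [← differentiableOn_univ]
    exact differentiableOn_det
      (ContinuousLinearMap.compL ℂ E F E (L : F →L[ℂ] E)).differentiable.differentiableOn
  let S : Set ℂ := (fun s : ℂ => s • x) ⁻¹' ball 0 r
  have hline : Differentiable ℂ fun s : ℂ => s • x := by fun_prop
  have hSo : IsOpen S := isOpen_ball.preimage hline.continuous
  have hSc : IsPreconnected S := by
    have : S = ((LinearMap.toSpanSingleton ℂ E x).restrictScalars ℝ) ⁻¹' ball 0 r := by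
      ext s
      simp [S]
    rw [this]
    exact ((convex_ball 0 r).linear_preimage _).isPreconnected
  have hhol : ∀ k : E → F, DifferentiableOn ℂ k (ball 0 r) →
      DifferentiableOn ℂ (fun s : ℂ => d (fderiv ℂ k (s • x))) S := fun k hk =>
    hdd.comp_differentiableOn
      ((differentiableOn_fderiv isOpen_ball hk).comp hline.differentiableOn fun s hs => hs)
  have h0S : (0 : ℂ) ∈ S := by simpa [S] using pos_of_mem_ball hx
  have h1S : (1 : ℂ) ∈ S := by simpa [S] using hx
  have key := ne_zero_of_tendsto_of_forall_ne_zero (l := l) hSo hSc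
    (v := fun i s => d (fderiv ℂ (f i) (s • x))) (w := fun s => d (fderiv ℂ g (s • x)))
    (hhol g hg) (by
      filter_upwards [hf] with i hi
      refine ⟨hhol (f i) hi.1, fun s hs => (hd _).2 ?_⟩
      exact injective_fderiv_of_injOn isOpen_ball hi.1 hdim hi.2 hs)
    (fun s hs => (hdd.continuous.tendsto _).comp ((hlim (s • x) hs).comp
      (tendsto_id.prodMap (hline.continuous.tendsto s))))
    h0S ((hd _).2 (by simpa using h0)) h1S
  simpa using (hd _).1 key

/-- If holomorphic maps converge to `g` together with their derivatives and the derivative of `g` at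
`x` is invertible, then the maps assume the value `g x` near `x`. -/
theorem eventually_mem_image_of_tendsto {ι : Type*} {l : Filter ι} {U : Set E} (hU : IsOpen U)
    (hdim : Module.finrank ℂ E = Module.finrank ℂ F) {f : ι → E → F} {g : E → F} {x : E}
    (hx : x ∈ U) (hf : ∀ᶠ i in l, DifferentiableOn ℂ (f i) U)
    (hlim : Tendsto (fun i => f i x) l (𝓝 (g x)))
    (hlim' : Tendsto (fun q : ι × E => fderiv ℂ (f q.1) q.2) (l ×ˢ 𝓝 x) (𝓝 (fderiv ℂ g x)))
    (hinj : Function.Injective (fderiv ℂ g x)) : ∀ᶠ i in l, g x ∈ f i '' U := by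
  rcases subsingleton_or_nontrivial F with hF | hF
  · exact Eventually.of_forall fun i => ⟨x, hx, Subsingleton.elim _ _⟩
  have : Nontrivial E := Module.nontrivial_of_finrank_pos (R := ℂ)
    (hdim ▸ Module.finrank_pos (R := ℂ) (M := F))
  have : CompleteSpace E := FiniteDimensional.complete ℂ E
  obtain ⟨A, hA⟩ : ∃ A : E ≃L[ℂ] F, (A : E →L[ℂ] F) = fderiv ℂ g x :=
    ⟨(LinearEquiv.ofInjectiveOfFinrankEq (fderiv ℂ g x : E →ₗ[ℂ] F)
      hinj hdim).toContinuousLinearEquiv, rfl⟩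
  rw [← hA] at hlim'
  set N : NNReal := ‖(A.symm : F →L[ℂ] E)‖₊ with hN
  have hN0 : 0 < N := (A.subsingleton_or_nnnorm_symm_pos).resolve_left
    (not_subsingleton E)
  set c : NNReal := N⁻¹ / 2 with hc
  have hc0 : 0 < c := half_pos (inv_pos.2 hN0)
  have hcN : (c : ℝ) = (N : ℝ)⁻¹ / 2 := by simp [hc]
  have hclose : ∀ᶠ q : ι × E in l ×ˢ 𝓝 x, ‖fderiv ℂ (f q.1) q.2 - A‖ ≤ c := by
    have h1 := (hlim'.sub_const (A : E →L[ℂ] F)).norm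
    rw [sub_self, norm_zero] at h1
    filter_upwards [h1.eventually_lt_const (NNReal.coe_pos.2 hc0)] with q hq using hq.le
  obtain ⟨a, ha, b, hb, hab⟩ := Filter.eventually_prod_iff.1 hclose
  obtain ⟨ε, hε, hεb⟩ := nhds_basis_closedBall.mem_iff.1 (inter_mem hb (hU.mem_nhds hx))
  have hpos : 0 < ((N : ℝ)⁻¹ - c) * ε := by
    rw [hcN]
    have : 0 < (N : ℝ)⁻¹ := inv_pos.2 (NNReal.coe_pos.2 hN0)
    exact mul_pos (by linarith) hε
  filter_upwards [hf, ha, hlim.eventually (closedBall_mem_nhds (g x) hpos)] with i hi hia hig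
  have hbound : ∀ w ∈ closedBall x ε, ‖fderiv ℂ (f i) w - A‖ ≤ c := fun w hw =>
    hab hia (hεb hw).1
  have happ : ApproximatesLinearOn (f i) (A : E →L[ℂ] F) (closedBall x ε) c := by
    intro y hy z hz
    exact (convex_closedBall x ε).norm_image_sub_le_of_norm_fderiv_le' (𝕜 := ℂ)
      (fun w hw => hi.differentiableAt (hU.mem_nhds (hεb hw).2))
      hbound hz hy
  have hsurj : SurjOn (f i) (closedBall x ε) (closedBall (f i x) (((N : ℝ)⁻¹ - c) * ε)) :=
    happ.surjOn_closedBall_of_nonlinearRightInverse A.toNonlinearRightInverse hε.le Subset.rfl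
  have hgi : g x ∈ closedBall (f i x) (((N : ℝ)⁻¹ - c) * ε) := mem_closedBall_comm.1 hig
  obtain ⟨y, hy, hyg⟩ := hsurj hgi
  exact ⟨y, (hεb hy).2, hyg⟩

/-- A bounded domain is biholomorphic to the unit ball if it is exhausted, along an ultrafilter, by
images of injective holomorphic maps of the ball which have the same value at the centre. -/
theorem biholomorphic_unitBall_of_exhausting {ι : Type*} (𝒰 : Ultrafilter ι) {n : ℕ}
    {D : Set (Cn n)} (hD : IsBoundedDomain D) {x₀ : Cn n} (f : ι → Cn n → Cn n)
    (hf : ∀ᶠ i in (𝒰 : Filter ι), IsBallEmbedding D x₀ (f i))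
    (hexh : ∀ w ∈ D, ∃ V ∈ 𝓝 w, ∀ᶠ i in (𝒰 : Filter ι), V ⊆ f i '' unitBall n) :
    Biholomorphic D (unitBall n) := by
  have hx₀ : x₀ ∈ D := by
    obtain ⟨i, hi⟩ := hf.exists
    rw [← hi.map_zero]
    exact hi.mapsTo (mem_ball_self one_pos)
  have hB0 : (0 : Cn n) ∈ unitBall n := mem_ball_self one_pos
  have hBo : IsOpen (unitBall n) := isOpen_ball
  obtain ⟨M, hM⟩ := hD.isBounded.exists_norm_le
  obtain ⟨g, hg⟩ := exists_ultralimit_of_locally_bounded 𝒰 (U := unitBall n) f fun x hx => by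
    obtain ⟨r, hr, hrB⟩ := Metric.isOpen_iff.1 hBo x hx
    refine ⟨r, hr, M, ?_⟩
    filter_upwards [hf] with i hi
    exact ⟨hi.holo.mono hrB, fun y hy => hM _ (hi.mapsTo (hrB hy))⟩
  -- the inverse maps and their limit
  set k : ι → Cn n → Cn n := fun i => Function.invFunOn (f i) (unitBall n) with hk
  have hkf : ∀ᶠ i in (𝒰 : Filter ι), LeftInvOn (k i) (f i) (unitBall n) ∧
      DifferentiableOn ℂ (k i) (f i '' unitBall n) := by
    filter_upwards [hf] with i hi
    have h1 : LeftInvOn (k i) (f i) (unitBall n) := hi.injOn.leftInvOn_invFunOn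
    exact ⟨h1, differentiableOn_leftInverse_of_injOn hBo hi.holo rfl h1⟩
  obtain ⟨h, hh⟩ := exists_ultralimit_of_locally_bounded 𝒰 (U := D) k fun w hw => by
    obtain ⟨V, hV, hVf⟩ := hexh w hw
    obtain ⟨r, hr, hrV⟩ := Metric.mem_nhds_iff.1 hV
    refine ⟨r, hr, 1, ?_⟩
    filter_upwards [hVf, hkf] with i hi hki
    refine ⟨hki.2.mono (hrV.trans hi), fun y hy => ?_⟩
    obtain ⟨x, hx, rfl⟩ := hi (hrV hy)
    rw [hki.1 hx]
    exact (mem_ball_zero_iff.1 hx).le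
  have hhw : ∀ w ∈ D, Tendsto (fun i => k i w) 𝒰 (𝓝 (h w)) := fun w hw =>
    (hh w hw).2.1.comp (tendsto_id.prodMk tendsto_const_nhds)
  have hgx : ∀ x ∈ unitBall n, Tendsto (fun i => f i x) 𝒰 (𝓝 (g x)) := fun x hx =>
    (hg x hx).2.1.comp (tendsto_id.prodMk tendsto_const_nhds)
  have hmem : ∀ w ∈ D, ∀ᶠ i in (𝒰 : Filter ι), w ∈ f i '' unitBall n := fun w hw => by
    obtain ⟨V, hV, hVf⟩ := hexh w hw
    filter_upwards [hVf] with i hi using hi (mem_of_mem_nhds hV)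
  have hh1 : ∀ w ∈ D, ‖h w‖ ≤ 1 := fun w hw => by
    refine le_of_tendsto (hhw w hw).norm ?_
    filter_upwards [hmem w hw, hkf] with i hi hki
    obtain ⟨x, hx, rfl⟩ := hi
    rw [hki.1 hx]
    exact (mem_ball_zero_iff.1 hx).le
  have hhd : DifferentiableOn ℂ h D := fun w hw => (hh w hw).1.differentiableWithinAt
  have hgd : DifferentiableOn ℂ g (unitBall n) := fun x hx => (hg x hx).1.differentiableWithinAt
  have hh0 : h x₀ = 0 := by
    refine tendsto_nhds_unique (hhw x₀ hx₀) (tendsto_const_nhds.congr' ?_)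
    filter_upwards [hf, hkf] with i hi hki
    rw [← hi.map_zero, hki.1 hB0]
  have hg0 : g 0 = x₀ := by
    refine tendsto_nhds_unique (hgx 0 hB0) (tendsto_const_nhds.congr' ?_)
    filter_upwards [hf] with i hi using hi.map_zero.symm
  -- by the maximum principle `h` maps into the open ball
  have hhB : MapsTo h D (unitBall n) := by
    intro w hw
    refine mem_ball_zero_iff.2 (lt_of_le_of_ne (hh1 w hw) fun hw1 => ?_)
    have h1 : IsMaxOn (norm ∘ h) D w := by
      intro y hy
      change ‖h y‖ ≤ ‖h w‖
      rw [hw1]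
      exact hh1 y hy
    have h2 := Complex.norm_eqOn_of_isPreconnected_of_isMaxOn hD.isConnected.isPreconnected
      hD.isOpen hhd hw h1 hx₀
    simp [hh0, hw1] at h2
  have hgh : ∀ w ∈ D, g (h w) = w := by
    intro w hw
    refine tendsto_nhds_unique ((hg _ (hhB hw)).2.1.comp (tendsto_id.prodMk (hhw w hw)))
      (tendsto_const_nhds.congr' ?_)
    filter_upwards [hmem w hw, hkf] with i hi hki
    obtain ⟨x, hx, rfl⟩ := hi
    simp [hki.1 hx]
  have hhg : ∀ x ∈ unitBall n, g x ∈ D → h (g x) = x := by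
    intro x hx hxD
    refine tendsto_nhds_unique ((hh _ hxD).2.1.comp (tendsto_id.prodMk (hgx x hx)))
      (tendsto_const_nhds.congr' ?_)
    filter_upwards [hkf] with i hki
    simp [hki.1 hx]
  have hinj0 : Function.Injective (fderiv ℂ g 0) := by
    have h1 : (h ∘ g) =ᶠ[𝓝 0] id := by
      have h2 : ∀ᶠ x in 𝓝 (0 : Cn n), g x ∈ D :=
        (hg 0 hB0).1.continuousAt.eventually (hD.isOpen.eventually_mem (hg0 ▸ hx₀))
      filter_upwards [h2, hBo.mem_nhds hB0] with x hxD hxB using hhg x hxB hxD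
    have h3 : HasFDerivAt (h ∘ g) ((fderiv ℂ h (g 0)).comp (fderiv ℂ g 0)) 0 :=
      (hh (g 0) (hg0 ▸ hx₀)).1.hasFDerivAt.comp 0 (hg 0 hB0).1.hasFDerivAt
    have h4 := (hasFDerivAt_id (𝕜 := ℂ) (0 : Cn n)).unique (h3.congr_of_eventuallyEq h1.symm)
    have h5 : Function.LeftInverse (fderiv ℂ h (g 0)) (fderiv ℂ g 0) := fun v =>
      (congrArg (fun A : Cn n →L[ℂ] Cn n => A v) h4).symm
    exact h5.injective
  have hgD : MapsTo g (unitBall n) D := by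
    intro x hx
    have hinj := injective_fderiv_of_tendsto (l := (𝒰 : Filter ι)) rfl
      (hf.mono fun i hi => ⟨hi.holo, hi.injOn⟩) hgd (fun y hy => (hg y hy).2.2) hinj0 hx
    have hev := eventually_mem_image_of_tendsto hBo rfl hx (hf.mono fun i hi => hi.holo)
      (hgx x hx) (hg x hx).2.2 hinj
    obtain ⟨i, ⟨y, hy, hyx⟩, hi⟩ := (hev.and hf).exists
    rw [← hyx]
    exact hi.mapsTo hy
  exact ⟨h, g, hhd, hgd, hhB, hgD, hgh, fun x hx => hhg x hx (hgD hx)⟩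

end Limits

/-! ### Automorphisms of the ball -/

section BallInvolution

open Metric

/-- The factor `√(1 - ‖a‖²)` in the formula for `ballInvolution`. -/
noncomputable def ballFactor {V : Type*} [NormedAddCommGroup V] (a : V) : ℝ := √(1 - ‖a‖ ^ 2)

variable {V : Type*} [NormedAddCommGroup V] [InnerProductSpace ℂ V]

/-- The linear map that fixes `a` and multiplies the vectors orthogonal to `a` by `ballFactor a`. It
is written without division by `‖a‖²`, so that `a = 0` needs no separate treatment. -/
noncomputable def ballLinear (a z : V) : V :=
  (ballFactor a : ℂ) • z + (inner ℂ a z / (1 + ballFactor a) : ℂ) • a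

/-- The holomorphic involution of the unit ball that interchanges `0` and `a`. -/
noncomputable def ballInvolution (a z : V) : V :=
  (1 - inner ℂ a z)⁻¹ • (a - ballLinear a z)

theorem ballFactor_sq {V : Type*} [NormedAddCommGroup V] {a : V} (ha : ‖a‖ < 1) :
    ballFactor a ^ 2 = 1 - ‖a‖ ^ 2 :=
  Real.sq_sqrt (by nlinarith [norm_nonneg a])

theorem ballFactor_pos {V : Type*} [NormedAddCommGroup V] {a : V} (ha : ‖a‖ < 1) :
    0 < ballFactor a :=
  Real.sqrt_pos.2 (by nlinarith [norm_nonneg a])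

theorem one_sub_inner_ne_zero {a z : V} (ha : ‖a‖ < 1) (hz : ‖z‖ < 1) :
    (1 - inner ℂ a z : ℂ) ≠ 0 := by
  intro h
  have h1 : ‖(inner ℂ a z : ℂ)‖ = 1 := by rw [← sub_eq_zero.1 h, norm_one]
  have h2 := norm_inner_le_norm (𝕜 := ℂ) a z
  nlinarith [norm_nonneg a, norm_nonneg z]

theorem ballInvolution_zero (a : V) : ballInvolution a 0 = a := by
  simp [ballInvolution, ballLinear]

theorem norm_sub_ballLinear_sq {a : V} (ha : ‖a‖ < 1) (z : V) :
    ‖a - ballLinear a z‖ ^ 2 =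
      ‖(1 - inner ℂ a z : ℂ)‖ ^ 2 - ballFactor a ^ 2 * (1 - ‖z‖ ^ 2) := by
  have hs := ballFactor_pos ha
  have hs2 := ballFactor_sq ha
  set s := ballFactor a with hsdef
  set α : ℂ := inner ℂ a z with hα
  have h1 : a - ballLinear a z = (1 - α / (1 + s) : ℂ) • a - (s : ℂ) • z := by
    rw [ballLinear, ← hsdef, ← hα]
    module
  have hre : (1 - α / (1 + s) : ℂ).re = 1 - α.re / (1 + s) := by
    rw [← Complex.ofReal_one, ← Complex.ofReal_add, Complex.sub_re, Complex.div_ofReal_re]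
    simp
  have him : (1 - α / (1 + s) : ℂ).im = - (α.im / (1 + s)) := by
    rw [← Complex.ofReal_one, ← Complex.ofReal_add, Complex.sub_im, Complex.div_ofReal_im]
    simp
  have h2 : (inner ℂ ((1 - α / (1 + s) : ℂ) • a) ((s : ℂ) • z) : ℂ) =
      (starRingEnd ℂ) (1 - α / (1 + s)) * (s * α) := by
    rw [inner_smul_left, inner_smul_right]
  rw [h1, norm_sub_sq (𝕜 := ℂ), h2, norm_smul, norm_smul, mul_pow, mul_pow,
    ← Complex.normSq_eq_norm_sq, ← Complex.normSq_eq_norm_sq, ← Complex.normSq_eq_norm_sq,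
    Complex.normSq_apply, Complex.normSq_apply, Complex.normSq_apply, hre, him]
  simp only [RCLike.re_to_complex, Complex.mul_re, Complex.mul_im, Complex.conj_re,
    Complex.conj_im, hre, him, Complex.ofReal_re, Complex.ofReal_im, Complex.sub_re,
    Complex.sub_im, Complex.one_re, Complex.one_im]
  have h3 : ‖a‖ ^ 2 = 1 - s ^ 2 := by linarith
  rw [h3]
  have h4 : 1 + s ≠ 0 := by positivity
  field_simp
  ring

theorem mapsTo_ballInvolution {a : V} (ha : ‖a‖ < 1) :
    MapsTo (ballInvolution a) (ball 0 1) (ball 0 1) := by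
  intro z hz
  rw [mem_ball_zero_iff] at hz ⊢
  have h0 : 0 < ‖(1 - inner ℂ a z : ℂ)‖ := norm_pos_iff.2 (one_sub_inner_ne_zero ha hz)
  rw [ballInvolution, norm_smul, norm_inv, inv_mul_lt_iff₀ h0, mul_one]
  refine lt_of_pow_lt_pow_left₀ 2 h0.le ?_
  rw [norm_sub_ballLinear_sq ha]
  have h1 := ballFactor_pos ha
  have h2 : 0 < 1 - ‖z‖ ^ 2 := by nlinarith [norm_nonneg z]
  have : 0 < ballFactor a ^ 2 * (1 - ‖z‖ ^ 2) := by positivity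
  linarith

theorem ballInvolution_ballInvolution {a z : V} (ha : ‖a‖ < 1) (hz : ‖z‖ < 1) :
    ballInvolution a (ballInvolution a z) = z := by
  have hs := ballFactor_pos ha
  have hs2 : ((ballFactor a : ℝ) : ℂ) ^ 2 = 1 - (‖a‖ : ℂ) ^ 2 := by
    exact_mod_cast ballFactor_sq ha
  have h1s : (1 + (ballFactor a : ℂ)) ≠ 0 := by
    have : 1 + ballFactor a ≠ 0 := by positivity
    exact_mod_cast this
  have hs0 : (ballFactor a : ℂ) ≠ 0 := by exact_mod_cast hs.ne'
  have hα0 := one_sub_inner_ne_zero ha hz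
  have haa : (inner ℂ a a : ℂ) = 1 - (ballFactor a : ℂ) ^ 2 := by
    rw [inner_self_eq_norm_sq_to_K, hs2]
    simp
  set w := ballInvolution a z with hw
  have hLz : (inner ℂ a (ballLinear a z) : ℂ) = inner ℂ a z := by
    rw [ballLinear, inner_add_right, inner_smul_right, inner_smul_right, haa]
    field_simp
    ring
  have hinner : (inner ℂ a w : ℂ) =
      (1 - inner ℂ a z)⁻¹ * (1 - (ballFactor a : ℂ) ^ 2 - inner ℂ a z) := by
    rw [hw, ballInvolution, inner_smul_right, inner_sub_right, haa, hLz]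
  have h1 : (1 - inner ℂ a w : ℂ) = (ballFactor a : ℂ) ^ 2 * (1 - inner ℂ a z)⁻¹ := by
    rw [hinner]
    field_simp
    ring
  have h2 : a - ballLinear a w = ((ballFactor a : ℂ) ^ 2 * (1 - inner ℂ a z)⁻¹) • z := by
    rw [ballLinear, hinner, hw, ballInvolution, ballLinear]
    set α : ℂ := inner ℂ a z
    set s : ℂ := (ballFactor a : ℂ)
    match_scalars <;> field_simp
    ring
  rw [ballInvolution, h1, h2, smul_smul, inv_mul_cancel₀ (by positivity), one_smul]

theorem differentiableOn_ballInvolution {a : V} (ha : ‖a‖ < 1) :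
    DifferentiableOn ℂ (ballInvolution a) (ball 0 1) := by
  have h1 : Differentiable ℂ fun z : V => (inner ℂ a z : ℂ) := (innerSL ℂ a).differentiable
  have h2 : Differentiable ℂ fun z : V => ballLinear a z := by
    unfold ballLinear
    fun_prop
  intro z hz
  refine DifferentiableAt.differentiableWithinAt ?_
  have h3 := one_sub_inner_ne_zero ha (mem_ball_zero_iff.1 hz)
  unfold ballInvolution
  exact ((((differentiableAt_const _).sub h1.differentiableAt).inv h3)).smul
    ((differentiableAt_const _).sub h2.differentiableAt)

end BallInvolution

/-- The centre of a ball embedding can be moved to each point of its image. -/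
theorem IsBallEmbedding.exists_recenter {n : ℕ} {D : Set (Cn n)} {z x : Cn n} {f : Cn n → Cn n}
    (hf : IsBallEmbedding D z f) (hx : x ∈ f '' unitBall n) :
    ∃ g, IsBallEmbedding D x g ∧ g '' unitBall n = f '' unitBall n := by
  obtain ⟨a, ha, rfl⟩ := hx
  have ha1 : ‖a‖ < 1 := mem_ball_zero_iff.1 ha
  have hmaps : MapsTo (ballInvolution a) (unitBall n) (unitBall n) := mapsTo_ballInvolution ha1
  have hinv : ∀ y ∈ unitBall n, ballInvolution a (ballInvolution a y) = y := fun y hy =>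
    ballInvolution_ballInvolution ha1 (mem_ball_zero_iff.1 hy)
  refine ⟨f ∘ ballInvolution a, ⟨hf.holo.comp (differentiableOn_ballInvolution ha1) hmaps,
    hf.mapsTo.comp hmaps, fun y hy y' hy' h => ?_, ?_⟩, ?_⟩
  · have := hf.injOn (hmaps hy) (hmaps hy') h
    rw [← hinv y hy, this, hinv y' hy']
  · rw [Function.comp_apply, ballInvolution_zero]
  · rw [image_comp]
    congr 1
    refine Subset.antisymm hmaps.image_subset fun y hy => ⟨_, hmaps hy, hinv y hy⟩

/-! ### The Kobayashi distance near a boundary point -/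

section Chains

open Metric

variable {n : ℕ} {D : Set (Cn n)}

theorem DiscChain.trans {x y w : Cn n} {L L' : ℝ} (h : DiscChain D x y L)
    (h' : DiscChain D y w L') : DiscChain D x w (L + L') := by
  induction h' with
  | nil hy => simpa using h
  | snoc L' f a b hf hfD ha hb _ ih =>
    rw [← add_assoc]
    exact DiscChain.snoc x _ f a b hf hfD ha hb ih

theorem DiscChain.single {f : ℂ → Cn n} (hf : DifferentiableOn ℂ f disc) (hfD : MapsTo f disc D)
    {a b : ℂ} (ha : a ∈ disc) (hb : b ∈ disc) : DiscChain D (f a) (f b) (poincareDist a b) := by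
  have := DiscChain.snoc (f a) 0 f a b hf hfD ha hb (DiscChain.nil (f a) (hfD ha))
  rwa [zero_add] at this

theorem poincareDist_zero_right (a : ℂ) : poincareDist a 0 = Real.log ((1 + ‖a‖) / (1 - ‖a‖)) := by
  simp [poincareDist, pseudoHyp]

theorem poincareDist_zero_left (a : ℂ) : poincareDist 0 a = Real.log ((1 + ‖a‖) / (1 - ‖a‖)) := by
  simp [poincareDist, pseudoHyp]

theorem discChain_affine {c v : Cn n} (h : ∀ ζ : ℂ, ‖ζ‖ < 1 → c + ζ • v ∈ D) {a : ℂ}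
    (ha : ‖a‖ < 1) :
    DiscChain D c (c + a • v) (Real.log ((1 + ‖a‖) / (1 - ‖a‖))) ∧
      DiscChain D (c + a • v) c (Real.log ((1 + ‖a‖) / (1 - ‖a‖))) := by
  have hf : DifferentiableOn ℂ (fun ζ : ℂ => c + ζ • v) disc := by fun_prop
  have hfD : MapsTo (fun ζ : ℂ => c + ζ • v) disc D := fun ζ hζ => h ζ (mem_ball_zero_iff.1 hζ)
  have ha' : a ∈ disc := mem_ball_zero_iff.2 ha
  have h0 : (0 : ℂ) ∈ disc := mem_ball_self one_pos
  constructor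
  · simpa [poincareDist_zero_left] using DiscChain.single hf hfD h0 ha'
  · simpa [poincareDist_zero_right] using DiscChain.single hf hfD ha' h0

theorem discChain_of_mem_ball {c y : Cn n} {r : ℝ} (hD : ball c r ⊆ D) (hy : y ∈ ball c (r / 2)) :
    DiscChain D c y (Real.log 3) ∧ DiscChain D y c (Real.log 3) := by
  have h1 : ∀ ζ : ℂ, ‖ζ‖ < 1 → c + ζ • ((2 : ℂ) • (y - c)) ∈ D := by
    intro ζ hζ
    refine hD ?_
    rw [mem_ball, dist_eq_norm] at hy ⊢
    rw [add_sub_cancel_left, norm_smul, norm_smul, Complex.norm_ofNat]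
    nlinarith [norm_nonneg (y - c), norm_nonneg ζ]
  have h2 : ‖(1 / 2 : ℂ)‖ = 1 / 2 := by simp
  have h3 := discChain_affine h1 (a := 1 / 2) (by rw [h2]; norm_num)
  rw [h2, smul_smul] at h3
  norm_num at h3
  exact h3

theorem exists_discChain (hD : IsOpen D) (hc : IsPreconnected D) {x y : Cn n} (hx : x ∈ D)
    (hy : y ∈ D) : ∃ L, DiscChain D x y L := by
  set S : Set (Cn n) := {y ∈ D | ∃ L, DiscChain D x y L} with hS
  set T : Set (Cn n) := {y ∈ D | ¬ ∃ L, DiscChain D x y L} with hT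
  have hSo : IsOpen S := by
    rw [Metric.isOpen_iff]
    rintro y ⟨hyD, L, hL⟩
    obtain ⟨r, hr, hrD⟩ := Metric.isOpen_iff.1 hD y hyD
    exact ⟨r / 2, by positivity, fun w hw => ⟨hrD (ball_subset_ball (by linarith) hw), _,
      hL.trans (discChain_of_mem_ball hrD hw).1⟩⟩
  have hTo : IsOpen T := by
    rw [Metric.isOpen_iff]
    rintro y ⟨hyD, hL⟩
    obtain ⟨r, hr, hrD⟩ := Metric.isOpen_iff.1 hD y hyD
    exact ⟨r / 2, by positivity, fun w hw => ⟨hrD (ball_subset_ball (by linarith) hw),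
      fun ⟨L, h⟩ => hL ⟨_, h.trans (discChain_of_mem_ball hrD hw).2⟩⟩⟩
  have hST : Disjoint S T := Set.disjoint_left.2 fun y hy hy' => hy'.2 hy.2
  have hsub : D ⊆ S ∪ T := fun y hy => by
    by_cases h : ∃ L, DiscChain D x y L
    · exact Or.inl ⟨hy, h⟩
    · exact Or.inr ⟨hy, h⟩
  exact (hc.subset_left_of_subset_union hSo hTo hST hsub ⟨x, hx, hx, 0, DiscChain.nil x hx⟩ hy).2

end Chains

section Boundary

open Metric

/-- The first order Taylor expansion of a `C²` function, locally uniform in the base point. -/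
theorem exists_quadratic_bound {E : Type*} [NormedAddCommGroup E] [NormedSpace ℝ E] {ρ : E → ℝ}
    {U : Set E} {p : E} (hU : U ∈ 𝓝 p) (hρ : ContDiffAt ℝ 2 ρ p)
    (hd : ∀ x ∈ U, DifferentiableAt ℝ ρ x) :
    ∃ r > 0, ball p r ⊆ U ∧ ∃ M > 0, ∀ x ∈ ball p r, ∀ y ∈ ball p r,
      |ρ y - ρ x - fderiv ℝ ρ x (y - x)| ≤ M * ‖y - x‖ ^ 2 := by
  obtain ⟨K, t, ht, hK⟩ :=
    (hρ.fderiv_right (m := 1) (by norm_num)).exists_lipschitzOnWith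
  obtain ⟨r, hr, hrt⟩ := Metric.mem_nhds_iff.1 (inter_mem hU ht)
  refine ⟨r, hr, hrt.trans inter_subset_left, K + 1, by positivity, fun x hx y hy => ?_⟩
  have hconv := (convex_ball p r).inter (convex_closedBall x ‖y - x‖)
  have h1 := hconv.norm_image_sub_le_of_norm_fderiv_le' (𝕜 := ℝ) (f := ρ)
    (φ := fderiv ℝ ρ x) (C := K * ‖y - x‖) (x := x) (y := y)
    (fun w hw => hd w (hrt hw.1).1) (fun w hw => ?_)
    ⟨hx, mem_closedBall_self (norm_nonneg _)⟩ ⟨hy, by rw [mem_closedBall, dist_eq_norm]⟩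
  · rw [Real.norm_eq_abs] at h1
    nlinarith [sq_nonneg ‖y - x‖]
  · have h2 := hK.dist_le_mul w (hrt hw.1).2 x (hrt hx).2
    have h3 := hw.2
    rw [dist_eq_norm] at h2
    rw [mem_closedBall] at h3
    exact h2.trans (by gcongr)

theorem infDist_frontier_le_dist {n : ℕ} {D : Set (Cn n)} {x y : Cn n} (hx : x ∈ D) (hy : y ∉ D) :
    infDist x (frontier D) ≤ dist x y := by
  obtain ⟨w, hw, hxw⟩ := exists_mem_frontier_infDist_compl_eq_dist hx
    (fun h => hy (h ▸ mem_univ y))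
  calc infDist x (frontier D) ≤ dist x w := infDist_le_dist_of_mem hw
    _ = infDist x Dᶜ := hxw.symm
    _ ≤ dist x y := infDist_le_dist_of_mem hy

theorem boundaryDist_pos {n : ℕ} {D : Set (Cn n)} (hD : IsOpen D) {p x : Cn n}
    (hp : p ∈ frontier D) (hx : x ∈ D) : 0 < boundaryDist D x := by
  refine (isClosed_frontier.notMem_iff_infDist_pos ⟨p, hp⟩).1 fun h => ?_
  rw [hD.frontier_eq] at h
  exact h.2 hx

variable {n : ℕ}

/-- The complex number `φ w - i φ (i w)`: it depends complex linearly on `w` and its real part is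
`φ w`. -/
noncomputable def complexify (w : Cn n) (φ : Cn n →L[ℝ] ℝ) : ℂ :=
  φ w - φ (Complex.I • w) * Complex.I

theorem continuous_complexify (w : Cn n) : Continuous (complexify w) := by
  have h1 : Continuous fun φ : Cn n →L[ℝ] ℝ => φ w :=
    (ContinuousLinearMap.apply ℝ ℝ w).continuous
  have h2 : Continuous fun φ : Cn n →L[ℝ] ℝ => φ (Complex.I • w) :=
    (ContinuousLinearMap.apply ℝ ℝ (Complex.I • w)).continuous
  unfold complexify
  exact (Complex.continuous_ofReal.comp h1).sub
    ((Complex.continuous_ofReal.comp h2).mul continuous_const)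

theorem apply_smul_eq_re_mul_complexify (w : Cn n) (φ : Cn n →L[ℝ] ℝ) (ζ : ℂ) :
    φ (ζ • w) = (ζ * complexify w φ).re := by
  have h1 : ζ • w = ζ.re • w + ζ.im • (Complex.I • w) := by
    conv_lhs => rw [← Complex.re_add_im ζ, add_smul, mul_smul]
    rw [Complex.coe_smul, Complex.coe_smul]
  rw [h1, map_add, map_smul, map_smul]
  simp [complexify]

theorem eventually_norm_le_of_continuousAt {X F : Type*} [TopologicalSpace X]
    [NormedAddCommGroup F] {u : X → F} {p : X} (hu : ContinuousAt u p) :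
    ∀ᶠ x in 𝓝 p, ‖u x‖ ≤ ‖u p‖ + 1 :=
  (hu.norm.eventually_lt_const (lt_add_one ‖u p‖)).mono fun _ h => h.le

/-- The upper estimate of the Kobayashi distance near a `C²` boundary point: from a point `z` near
`p` some point in a fixed small neighbourhood of an inner point `c` can be reached by one affine
disc of Poincaré length at most `log (1 / δ(z)) + C`. -/
theorem exists_discChain_near_boundary {D : Set (Cn n)} (hD : IsOpen D) {p : Cn n}
    (hp : IsC2BoundaryPoint D p) :
    ∃ c ∈ D, ∃ C : ℝ, ∀ W ∈ 𝓝 c, ∀ᶠ z in 𝓝[D] p, ∃ y ∈ W, ∃ L,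
      L ≤ Real.log (1 / boundaryDist D z) + C ∧ DiscChain D z y L := by
  obtain ⟨hpD, U, ρ, hU, hpU, hρ, hρp, hDU⟩ := hp
  have hρpC : ContDiffAt ℝ 2 ρ p := hρ.contDiffAt (hU.mem_nhds hpU)
  obtain ⟨r, hr, hrU, M, hM, hquad⟩ := exists_quadratic_bound (hU.mem_nhds hpU) hρpC
    fun x hx => (hρ.contDiffAt (hU.mem_nhds hx)).differentiableAt (by norm_num)
  have hmem : ∀ x ∈ ball p r, ρ x < 0 → x ∈ D := fun x hx hρx => by
    have : x ∈ D ∩ U := by rw [hDU]; exact ⟨hrU hx, hρx⟩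
    exact this.1
  have hneg : ∀ x ∈ ball p r, x ∈ D → ρ x < 0 := fun x hx hxD => by
    have : x ∈ {x ∈ U | ρ x < 0} := by rw [← hDU]; exact ⟨hxD, hrU hx⟩
    exact this.2
  have hpr : p ∈ ball p r := mem_ball_self hr
  have hclos : p ∈ closure D := frontier_subset_closure hpD
  have hpnD : p ∉ D := by
    rw [hD.frontier_eq] at hpD
    exact hpD.2
  have hρc : ContinuousAt ρ p := hρpC.continuousAt
  have hρ0 : ρ p = 0 := by
    refine le_antisymm ?_ (not_lt.1 fun h => hpnD (hmem p hpr h))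
    have : (𝓝[D] p).NeBot := mem_closure_iff_nhdsWithin_neBot.1 hclos
    refine le_of_tendsto (hρc.tendsto.mono_left (nhdsWithin_le_nhds (s := D))) ?_
    filter_upwards [nhdsWithin_le_nhds (ball_mem_nhds p hr), self_mem_nhdsWithin] with x hx hxD
    exact (hneg x hx hxD).le
  -- the inward direction `u z` depends continuously on `z`
  obtain ⟨w, hw⟩ : ∃ w, fderiv ℝ ρ p w ≠ 0 := by
    by_contra! h
    exact hρp (ContinuousLinearMap.ext h)
  set A : Cn n → ℂ := fun z => complexify w (fderiv ℝ ρ z) with hA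
  have hAp : A p ≠ 0 := by
    intro h
    have := apply_smul_eq_re_mul_complexify w (fderiv ℝ ρ p) 1
    rw [one_smul, one_mul] at this
    rw [this] at hw
    exact hw (by rw [show complexify w (fderiv ℝ ρ p) = 0 from h, Complex.zero_re])
  have hAc : ContinuousAt A p := (continuous_complexify w).continuousAt.comp
    (hρpC.fderiv_right (m := 1) (by norm_num)).continuousAt
  set u : Cn n → Cn n := fun z => (-(A z)⁻¹) • w with hu
  have huc : ContinuousAt u p := ((hAc.inv₀ hAp).neg).smul continuousAt_const
  have hdu : ∀ z, A z ≠ 0 → ∀ ζ : ℂ, fderiv ℝ ρ z (ζ • u z) = -ζ.re := by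
    intro z hz ζ
    rw [hu, smul_smul, apply_smul_eq_re_mul_complexify]
    have : ζ * -(A z)⁻¹ * complexify w (fderiv ℝ ρ z) = -ζ := by
      change ζ * -(A z)⁻¹ * A z = -ζ
      field_simp
    rw [this, Complex.neg_re]
  set K : ℝ := ‖u p‖ + 1 with hK
  have hK1 : 1 ≤ K := by linarith [norm_nonneg (u p)]
  have hK0 : 0 < K := by linarith
  have hMK : 0 < M * K ^ 2 := by positivity
  -- `R` is the radius of the discs: on them the second order term of `ρ` is dominated, and they
  -- stay in the ball on which `ρ` is controlled
  set R : ℝ := min (1 / (2 * (M * K ^ 2))) (r / (8 * K)) with hR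
  have hR0 : 0 < R := by positivity
  have hR1 : 2 * (M * K ^ 2) * R ≤ 1 := by
    have : R ≤ 1 / (2 * (M * K ^ 2)) := min_le_left _ _
    rw [le_div_iff₀ (by positivity)] at this
    linarith
  have hR2 : 8 * K * R ≤ r := by
    have : R ≤ r / (8 * K) := min_le_right _ _
    rw [le_div_iff₀ (by positivity)] at this
    linarith
  -- estimate of the defining function on the complex line in the direction `u z`
  have hline : ∀ z ∈ ball p (r / 2), A z ≠ 0 → ‖u z‖ ≤ K → ∀ ζ : ℂ, ‖ζ‖ * K < r / 2 →
      z + ζ • u z ∈ ball p r ∧ |ρ (z + ζ • u z) - ρ z + ζ.re| ≤ M * K ^ 2 * ‖ζ‖ ^ 2 := by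
    intro z hz hAz hKz ζ hζ
    have h1 : ‖ζ • u z‖ ≤ ‖ζ‖ * K := by
      rw [norm_smul]
      gcongr
    have h2 : z + ζ • u z ∈ ball p r := by
      rw [mem_ball, dist_eq_norm] at *
      calc ‖z + ζ • u z - p‖ = ‖(z - p) + ζ • u z‖ := by congr 1; abel
        _ ≤ _ := norm_add_le _ _
        _ < r := by linarith
    refine ⟨h2, ?_⟩
    have h3 := hquad z (ball_subset_ball (by linarith) hz) _ h2
    rw [add_sub_cancel_left, hdu z hAz, sub_neg_eq_add] at h3
    refine h3.trans ?_
    calc M * ‖ζ • u z‖ ^ 2 ≤ M * (‖ζ‖ * K) ^ 2 := by gcongr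
      _ = _ := by ring
  -- the centre of the disc through `z`, see `hcz` below
  set cen : Cn n → Cn n := fun z => z + ((R + ρ z / 2 : ℝ) : ℂ) • u z with hcen
  have hcenc : ContinuousAt cen p := by
    have h1 : ContinuousAt (fun z => ((R + ρ z / 2 : ℝ) : ℂ)) p :=
      Complex.continuous_ofReal.continuousAt.comp (continuousAt_const.add (hρc.div_const 2))
    exact continuousAt_id.add (h1.smul huc)
  have hcenp : cen p ∈ D := by
    have hnR : ‖((R : ℝ) : ℂ)‖ = R := by rw [Complex.norm_real, Real.norm_of_nonneg hR0.le]
    have h1 := hline p (mem_ball_self (by positivity)) hAp (by linarith) (R : ℂ)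
      (by rw [hnR]; nlinarith)
    have h2 : cen p = p + (R : ℂ) • u p := by simp [hcen, hρ0]
    rw [h2]
    refine hmem _ h1.1 ?_
    have h3 := (abs_le.1 h1.2).2
    rw [hρ0, hnR, Complex.ofReal_re] at h3
    nlinarith
  refine ⟨cen p, hcenp, Real.log (8 * R * K), fun W hW => ?_⟩
  have hev : ∀ᶠ z in 𝓝 p, z ∈ ball p (r / 2) ∧ A z ≠ 0 ∧ ‖u z‖ ≤ K ∧ cen z ∈ W ∧
      -ρ z < R / 2 := by
    refine (isOpen_ball.eventually_mem (mem_ball_self (by positivity))).and <|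
      (hAc.eventually_ne hAp).and <|
      (eventually_norm_le_of_continuousAt huc).and <| (hcenc.eventually hW).and ?_
    exact hρc.neg.eventually_lt_const (by rw [Pi.neg_apply, hρ0, neg_zero]; positivity)
  filter_upwards [nhdsWithin_le_nhds hev, self_mem_nhdsWithin] with z hz hzD
  obtain ⟨hzr, hAz, hKz, hzW, hρR⟩ := hz
  have hρz : ρ z < 0 := hneg z (ball_subset_ball (by linarith) hzr) hzD
  -- `τ` is the depth of `z` in the disc of radius `R` around `cen z = z + (R - τ) u z`
  set τ : ℝ := -ρ z / 2 with hτ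
  have hτ0 : 0 < τ := by linarith
  have hτR : τ ≤ R / 4 := by linarith
  have hδ0 : 0 < boundaryDist D z := boundaryDist_pos hD hpD hzD
  -- the point `z - 4 τ u z` is outside of `D`
  have hδ : boundaryDist D z ≤ 4 * τ * K := by
    have hn : ‖((-(4 * τ) : ℝ) : ℂ)‖ = 4 * τ := by
      rw [Complex.norm_real, Real.norm_eq_abs, abs_neg, abs_of_pos (by positivity)]
    have h1 := hline z hzr hAz hKz ((-(4 * τ) : ℝ) : ℂ)
      (by rw [hn]; nlinarith only [hτR, hR2, hK0, hr, hτ0])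
    have h2 : z + ((-(4 * τ) : ℝ) : ℂ) • u z ∉ D := by
      intro hcon
      have h3 := hneg _ h1.1 hcon
      have h4 := (abs_le.1 h1.2).1
      rw [hn, Complex.ofReal_re] at h4
      have h5 : M * K ^ 2 * (4 * τ) ^ 2 ≤ 2 * τ := by
        have h6 : M * K ^ 2 * (8 * τ) ≤ 1 :=
          le_trans (by nlinarith only [hMK, hτR]) hR1
        nlinarith only [h6, hτ0]
      linarith
    refine (infDist_frontier_le_dist hzD h2).trans ?_
    rw [dist_self_add_right, norm_smul, hn]
    gcongr
  have hRC : ((R : ℝ) : ℂ) ≠ 0 := Complex.ofReal_ne_zero.2 hR0.ne'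
  have hcz : cen z = z + ((R - τ : ℝ) : ℂ) • u z := by
    simp only [hcen, hτ]
    congr 3
    ring
  have hdisc : ∀ ξ : ℂ, ‖ξ‖ < 1 → cen z + ξ • ((R : ℂ) • u z) ∈ D := by
    intro ξ hξ
    set ζ : ℂ := ((R - τ : ℝ) : ℂ) + ξ * R with hζ
    have h1 : cen z + ξ • ((R : ℂ) • u z) = z + ζ • u z := by
      rw [hcz, hζ]
      module
    have hξR : ‖ξ * (R : ℂ)‖ < R := by
      rw [norm_mul, Complex.norm_real, Real.norm_of_nonneg hR0.le]
      nlinarith only [hξ, hR0]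
    have hζn : ‖ζ‖ < 2 * R := by
      refine (norm_add_le _ _).trans_lt ?_
      rw [Complex.norm_real, Real.norm_of_nonneg (by linarith)]
      linarith
    have hl := hline z hzr hAz hKz ζ (by nlinarith only [hζn, hK0, hR2, hr])
    rw [h1]
    refine hmem _ hl.1 ?_
    have h2 := (abs_le.1 hl.2).2
    have h3 : M * K ^ 2 * ‖ζ‖ ^ 2 ≤ ‖ζ‖ ^ 2 / (2 * R) := by
      rw [le_div_iff₀ (by positivity)]
      nlinarith only [sq_nonneg ‖ζ‖, hR1]
    -- `ζ` lies in the disc of radius `R` around `R - τ`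
    have h4 : ‖ζ‖ ^ 2 - 2 * (R - τ) * ζ.re + (R - τ) ^ 2 < R ^ 2 := by
      have h5 : ‖ζ - ((R - τ : ℝ) : ℂ)‖ ^ 2 =
          ‖ζ‖ ^ 2 - 2 * (R - τ) * ζ.re + (R - τ) ^ 2 := by
        rw [← Complex.normSq_eq_norm_sq, ← Complex.normSq_eq_norm_sq, Complex.normSq_apply,
          Complex.normSq_apply, Complex.sub_re, Complex.sub_im, Complex.ofReal_re,
          Complex.ofReal_im]
        ring
      rw [← h5]
      have h6 : ‖ζ - ((R - τ : ℝ) : ℂ)‖ < R := by rwa [hζ, add_sub_cancel_left]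
      exact pow_lt_pow_left₀ h6 (norm_nonneg _) two_ne_zero
    have h7 : -τ < ζ.re := by
      have h8 := (abs_le.1 (Complex.abs_re_le_norm (ξ * (R : ℂ)))).1
      rw [hζ, Complex.add_re, Complex.ofReal_re]
      linarith
    have h9 : ‖ζ‖ ^ 2 / (2 * R) < 2 * τ + ζ.re := by
      rw [div_lt_iff₀ (by positivity)]
      nlinarith only [h4, mul_pos hτ0 (by linarith : 0 < ζ.re + τ),
        mul_nonneg hτ0.le (by linarith : 0 ≤ R - τ), sq_nonneg τ]
    linarith
  set t : ℝ := 1 - τ / R with ht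
  have hτR' : τ / R ≤ 1 / 2 := by
    rw [div_le_iff₀ hR0]
    linarith
  have hτR0 : 0 < τ / R := by positivity
  have htn : ‖((-t : ℝ) : ℂ)‖ = t := by
    rw [Complex.norm_real, Real.norm_eq_abs, abs_neg, abs_of_pos (by linarith)]
  have hchain := (discChain_affine hdisc (a := ((-t : ℝ) : ℂ)) (by rw [htn]; linarith)).2
  have hzeq : cen z + ((-t : ℝ) : ℂ) • ((R : ℂ) • u z) = z := by
    have h1 : ((-t : ℝ) : ℂ) * (R : ℂ) = -((R - τ : ℝ) : ℂ) := by
      rw [← Complex.ofReal_mul, ← Complex.ofReal_neg]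
      congr 1
      rw [ht]
      field_simp
    rw [smul_smul, h1, hcz]
    module
  rw [hzeq, htn] at hchain
  refine ⟨cen z, hzW, _, ?_, hchain⟩
  rw [← Real.log_mul (by positivity) (by positivity)]
  refine Real.log_le_log (div_pos (by linarith) (by linarith)) ?_
  have h1 : (1 + t) / (1 - t) ≤ 2 / (τ / R) := by
    have : 1 - t = τ / R := by rw [ht]; ring
    rw [this]
    gcongr
    linarith
  refine h1.trans ?_
  rw [div_mul_eq_mul_div, one_mul, div_div_eq_mul_div, div_le_div_iff₀ hτ0 hδ0]
  nlinarith only [hδ, hR0]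

/-- From the points near a `C²` boundary point each point `y` near a given `w ∈ D` can be reached by
a chain of length at most `log (1 / δ(z)) + C`. -/
theorem exists_discChain_le_log {D : Set (Cn n)} (hD : IsBoundedDomain D) {p : Cn n}
    (hp : IsC2BoundaryPoint D p) {w : Cn n} (hw : w ∈ D) :
    ∃ V ∈ 𝓝 w, V ⊆ D ∧ ∃ C : ℝ, ∀ᶠ z in 𝓝[D] p, ∀ y ∈ V, ∃ L,
      L ≤ Real.log (1 / boundaryDist D z) + C ∧ DiscChain D z y L := by
  obtain ⟨c, hc, C, hC⟩ := exists_discChain_near_boundary hD.isOpen hp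
  obtain ⟨r, hr, hrD⟩ := Metric.isOpen_iff.1 hD.isOpen c hc
  obtain ⟨s, hs, hsD⟩ := Metric.isOpen_iff.1 hD.isOpen w hw
  obtain ⟨L₀, hL₀⟩ := exists_discChain hD.isOpen hD.isConnected.isPreconnected hc hw
  refine ⟨ball w (s / 2), ball_mem_nhds w (by positivity),
    (ball_subset_ball (by linarith)).trans hsD, C + Real.log 3 + L₀ + Real.log 3, ?_⟩
  filter_upwards [hC _ (ball_mem_nhds c (half_pos hr))] with z hz y hy
  obtain ⟨x, hx, L, hL, hchain⟩ := hz
  exact ⟨_, by linarith, ((hchain.trans (discChain_of_mem_ball hrD hx).2).trans hL₀).trans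
    (discChain_of_mem_ball hsD hy).1⟩

end Boundary

/-! ### The Fridman invariant -/

section Invariant

variable {n : ℕ} {D : Set (Cn n)}

theorem kobayashiDist_le_of_discChain {x y : Cn n} {L : ℝ} (h : DiscChain D x y L) :
    kobayashiDist D x y ≤ ENNReal.ofReal L :=
  iInf₂_le L h

/-- If `e_D(z)` exceeds `1 - η`, then some ball embedding covers a Kobayashi ball of radius more
than `log (1 / η)`. -/
theorem exists_isBallEmbedding_of_lt_fridmanE {z : Cn n} {η : ℝ} (hη : 0 < η) (hη1 : η < 1)
    (he : 1 - η < fridmanE D z) :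
    ∃ f, IsBallEmbedding D z f ∧ ∃ r, Real.log (1 / η) < r ∧
      kobayashiBall D z r ⊆ f '' unitBall n := by
  have hlog : 0 < Real.log (1 / η) := Real.log_pos (by rw [lt_div_iff₀ hη]; linarith)
  have hH : fridmanH D z < (ENNReal.ofReal (Real.log (1 / η)))⁻¹ := by
    by_cases h0 : fridmanH D z = 0
    · rw [h0, ENNReal.inv_pos]
      exact ENNReal.ofReal_ne_top
    · have he' := he
      rw [fridmanE, if_neg h0] at he'
      set t := ((fridmanH D z)⁻¹).toReal with ht
      have h1 : 0 < Real.exp t + 1 := by positivity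
      rw [lt_div_iff₀ h1] at he'
      have h2 : 1 / η < Real.exp t := by
        rw [div_lt_iff₀ hη]
        nlinarith
      have h3 : Real.log (1 / η) < t := (Real.log_lt_iff_lt_exp (by positivity)).2 h2
      rw [ENNReal.lt_inv_iff_lt_inv]
      exact (ENNReal.ofReal_lt_iff_lt_toReal hlog.le (ENNReal.inv_ne_top.2 h0)).2 h3
  obtain ⟨f, hf⟩ := iInf_lt_iff.1 hH
  obtain ⟨hfe, hq⟩ := iInf_lt_iff.1 hf
  rw [ENNReal.inv_lt_inv] at hq
  obtain ⟨r, hr⟩ := lt_iSup_iff.1 hq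
  obtain ⟨hr0, hr⟩ := lt_iSup_iff.1 hr
  obtain ⟨hsub, hr⟩ := lt_iSup_iff.1 hr
  exact ⟨f, hfe, r, (ENNReal.ofReal_lt_ofReal_iff hr0).1 hr, hsub⟩

end Invariant

end Fridman

theorem theorem1p3 {n : ℕ} (D : Set (Fridman.Cn n)) (hD : Fridman.IsBoundedDomain D)
    (p : Fridman.Cn n) (hp : Fridman.IsC2BoundaryPoint D p)
    (z : ℕ → Fridman.Cn n) (hzD : ∀ j, z j ∈ D) (hz : Tendsto z atTop (𝓝 p))
    (ε : ℕ → ℝ) (hεpos : ∀ j, 0 < ε j) (hε : Tendsto ε atTop (𝓝 0))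
    (he : ∀ j, 1 - ε j * Fridman.boundaryDist D (z j) < Fridman.fridmanE D (z j)) :
    Fridman.Biholomorphic D (Fridman.unitBall n) := by
  have hzp : Tendsto z atTop (𝓝[D] p) :=
    tendsto_nhdsWithin_iff.2 ⟨hz, Eventually.of_forall hzD⟩
  have hδpos : ∀ j, 0 < Fridman.boundaryDist D (z j) := fun j =>
    Fridman.boundaryDist_pos hD.isOpen hp.1 (hzD j)
  have hδ : Tendsto (fun j => Fridman.boundaryDist D (z j)) atTop (𝓝 0) := by
    have h1 := ((Metric.continuous_infDist_pt (frontier D)).tendsto p).comp hz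
    rwa [Metric.infDist_zero_of_mem hp.1] at h1
  have hη1 : ∀ᶠ j in atTop, ε j * Fridman.boundaryDist D (z j) < 1 := by
    have h1 := hε.mul hδ
    rw [mul_zero] at h1
    exact h1.eventually_lt_const one_pos
  have hemb : ∀ᶠ j in atTop, ∃ f, Fridman.IsBallEmbedding D (z j) f ∧ ∃ r,
      Real.log (1 / (ε j * Fridman.boundaryDist D (z j))) < r ∧
        Fridman.kobayashiBall D (z j) r ⊆ f '' Fridman.unitBall n := by
    filter_upwards [hη1] with j hj
    exact Fridman.exists_isBallEmbedding_of_lt_fridmanE (mul_pos (hεpos j) (hδpos j)) hj (he j)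
  -- the images of the embeddings exhaust `D`, because `log (1 / ε j)` tends to infinity
  have hlog : Tendsto (fun j => Real.log (1 / ε j)) atTop atTop := by
    have h1 : Tendsto ε atTop (𝓝[>] 0) :=
      tendsto_nhdsWithin_iff.2 ⟨hε, Eventually.of_forall hεpos⟩
    simp only [one_div]
    exact Real.tendsto_log_atTop.comp (tendsto_inv_nhdsGT_zero.comp h1)
  choose! f hf r hr hsub using fun j (h : ∃ f, Fridman.IsBallEmbedding D (z j) f ∧ ∃ r,
      Real.log (1 / (ε j * Fridman.boundaryDist D (z j))) < r ∧
        Fridman.kobayashiBall D (z j) r ⊆ f '' Fridman.unitBall n) => h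
  have hexh : ∀ w ∈ D, ∃ V ∈ 𝓝 w, ∀ᶠ j in atTop, V ⊆ f j '' Fridman.unitBall n := by
    intro w hw
    obtain ⟨V, hV, hVD, C, hC⟩ := Fridman.exists_discChain_le_log hD hp hw
    refine ⟨V, hV, ?_⟩
    filter_upwards [hemb, hzp.eventually hC, hlog.eventually_ge_atTop C, hη1]
      with j hj hCj hjC hj1
    intro y hy
    refine hsub j hj ⟨hVD hy, ?_⟩
    obtain ⟨L, hL, hchain⟩ := hCj y hy
    refine (Fridman.kobayashiDist_le_of_discChain hchain).trans_lt ?_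
    have h1 : Real.log (1 / (ε j * Fridman.boundaryDist D (z j))) =
        Real.log (1 / ε j) + Real.log (1 / Fridman.boundaryDist D (z j)) := by
      rw [← Real.log_mul (one_div_pos.2 (hεpos j)).ne' (one_div_pos.2 (hδpos j)).ne']
      congr 1
      field_simp
    have h2 := hr j hj
    have h3 : 0 < r j := by
      refine (Real.log_pos ?_).trans h2
      rwa [lt_div_iff₀ (mul_pos (hεpos j) (hδpos j)), one_mul]
    exact (ENNReal.ofReal_lt_ofReal_iff h3).2 (by linarith)
  obtain ⟨𝒰, h𝒰⟩ : ∃ 𝒰 : Ultrafilter ℕ, (𝒰 : Filter ℕ) ≤ atTop :=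
    ⟨Ultrafilter.of atTop, Ultrafilter.of_le _⟩
  have hrec : ∀ᶠ j in atTop, ∃ g, Fridman.IsBallEmbedding D (z 0) g ∧
      g '' Fridman.unitBall n = f j '' Fridman.unitBall n := by
    obtain ⟨V, hV, hVf⟩ := hexh (z 0) (hzD 0)
    filter_upwards [hemb, hVf] with j hj hVj
    exact (hf j hj).exists_recenter (hVj (mem_of_mem_nhds hV))
  choose! g hg hgf using fun j (h : ∃ g, Fridman.IsBallEmbedding D (z 0) g ∧
      g '' Fridman.unitBall n = f j '' Fridman.unitBall n) => h
  refine Fridman.biholomorphic_unitBall_of_exhausting 𝒰 hD (x₀ := z 0) g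
    (h𝒰 (hrec.mono fun j hj => hg j hj)) fun w hw => ?_
  obtain ⟨V, hV, hVf⟩ := hexh w hw
  refine ⟨V, hV, h𝒰 ?_⟩
  filter_upwards [hrec, hVf] with j hj hVj
  rw [hgf j hj]
  exact hVj
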